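/- Let $\mathcal G$ be a first-order structure in which a group $G$, an abelian group $A$ and an action of $G$ on $A$ by automorphisms are $\emptyset$-definable. Let $B\subset\mathcal G$ be a finite set of parameters and let $h\colon G\times G\to A$ be a 2-cocycle, i.e. $h(x,y)+h(xy,z)=h(x,yz)+x\cdot h(y,z)$ and $h(x,e)=h(e,x)=0$, such that $h$ is $B$-definable and its image is finite and contained in $\mathrm{dcl}(B)$. Let $A_0\le A$ be the subgroup generated by the image of $h$. Let $\mathcal G^*\succ\mathcal G$ be a monster model: for some uncountable strong limit cardinal $\kappa$ greater than the cardinality of the language, $\mathcal G^*$ is $\kappa$-saturated and strongly $\kappa$-homogeneous; "bounded" means "of cardinality $<\kappa$". Write $G^*,A^*,h^*$ for the interpretations of $G,A,h$ in $\mathcal G^*$, and let $\widetilde{G^*}=A^*\times G^*$ be the group with multiplication $(a_1,g_1)(a_2,g_2)=(a_1+g_1\cdot a_2+h^*(g_1,g_2),\,g_1g_2)$; $A^*$ is identified with $A^*\times\{e\}$. For $X=G^*$ or $X=\widetilde{G^*}$, let $X^{000}_B$ be the smallest subgroup of $X$ of bounded index that is invariant under $\mathrm{Aut}(\mathcal G^*/B)$,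 and $X^{00}_B$ the smallest subgroup of $X$ of bounded index that is type-definable over $B$. Let $A^*_1\le A^*$ be a subgroup of bounded index which is type-definable over $B$ and invariant under the action of $G^*$. For a subgroup $H\le G^*$, the 2-cocycle $\overline{h^*}_{|H\times H}\colon H\times H\to A_0/(A^*_1\cap A_0)$ induced by $h^*$ is called non-split via $B$-invariant functions if there is no $\mathrm{Aut}(\mathcal G^*/B)$-invariant function $f\colon H\to A_0/(A^*_1\cap A_0)$ with $f(e)=0$ and $\overline{h^*}(x,y)=f(x)+x\cdot f(y)-f(xy)$ for all $x,y\in H$. Then: (1) Suppose that ${G^*}^{000}_B={G^*}^{00}_B$ and $A^*_1\subseteq\widetilde{G^*}^{000}_B\cap A^*$. If $\widetilde{G^*}^{000}_B\ne\widetilde{G^*}^{00}_B$, then $\widetilde{G^*}^{00}_B\cap A^*\not\subseteq A^*_1$. If moreover $A_0/(A^*_1\cap A_0)$ is torsion free, then conversely $\widetilde{G^*}^{00}_B\cap A^*\not\subseteq A^*_1$ implies $\widetilde{G^*}^{000}_B\ne\widetilde{G^*}^{00}_B$. (2) The induced 2-cocycle $\overline{h^*}_{|{G^*}^{000}_B\times{G^*}^{000}_B}\colon{G^*}^{000}_B\times{G^*}^{000}_B\to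 A_0/(A^*_1\cap A_0)$ is non-split via $B$-invariant functions if and only if $\widetilde{G^*}^{000}_B\cap A^*\not\subseteq A^*_1$. -/

import Mathlib

open FirstOrder Cardinal

namespace ConnComp

universe u v w w'

/-! ### Factor sets and the extensions they define -/

/-- A (normalised) 2-cocycle, or factor set, `h : G × G → A`. -/
structure FactorSet (G A : Type*) [Group G] [AddCommGroup A] [DistribMulAction G A] where
  /-- the underlying function -/
  toFun : G → G → A
  cocycle : ∀ x y z, toFun x y + toFun (x * y) z = toFun x (y * z) + x • toFun y z
  map_one_right : ∀ x, toFun x 1 = 0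
  map_one_left : ∀ x, toFun 1 x = 0

/-- The underlying set `A × G` of the extension of `G` by `A` defined by the 2-cocycle `h`. -/
@[ext]
structure Ext {G A : Type*} [Group G] [AddCommGroup A] [DistribMulAction G A]
    (h : FactorSet G A) where
  /-- the component in `A` -/
  fst : A
  /-- the component in `G` -/
  snd : G

namespace Ext

variable {G A : Type*} [Group G] [AddCommGroup A] [DistribMulAction G A] {h : FactorSet G A}

instance : Mul (Ext h) := ⟨fun p q => ⟨p.fst + p.snd • q.fst + h.toFun p.snd q.snd, p.snd * q.snd⟩⟩

instance : One (Ext h) := ⟨⟨0, 1⟩⟩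

instance : Inv (Ext h) := ⟨fun p => ⟨-(p.snd⁻¹ • p.fst) - h.toFun p.snd⁻¹ p.snd, p.snd⁻¹⟩⟩

theorem mul_def (p q : Ext h) :
    p * q = ⟨p.fst + p.snd • q.fst + h.toFun p.snd q.snd, p.snd * q.snd⟩ := rfl

theorem one_def : (1 : Ext h) = ⟨0, 1⟩ := rfl

theorem inv_def (p : Ext h) :
    p⁻¹ = ⟨-(p.snd⁻¹ • p.fst) - h.toFun p.snd⁻¹ p.snd, p.snd⁻¹⟩ := rfl

/-- The group `(A × G, *)`, where
`(a₁, g₁) * (a₂, g₂) = (a₁ + g₁ • a₂ + h (g₁, g₂), g₁ g₂)`. -/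
instance : Group (Ext h) :=
  Group.ofLeftAxioms
    (by
      intro p q r
      simp only [mul_def, Ext.mk.injEq, mul_assoc, and_true, smul_add, mul_smul]
      have := h.cocycle p.snd q.snd r.snd
      have h2 := eq_sub_of_add_eq this
      rw [h2]
      abel)
    (by
      intro p
      simp [mul_def, one_def, h.map_one_left])
    (by
      intro p
      simp only [mul_def, one_def, inv_def, Ext.mk.injEq, inv_mul_cancel, and_true]
      abel)

/-- The set `H ∩ A`, where `A` is identified with the subgroup `A × {1}` of the extension. -/
def interA (H : Subgroup (Ext h)) : Set A := {a | (⟨a, 1⟩ : Ext h) ∈ H}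

end Ext

/-! ### Monster models -/

/-- `N` is `κ`-saturated: every finitely satisfiable set of formulas in finitely many variables
with fewer than `κ` parameters is realised. -/
def IsSaturated (L : FirstOrder.Language.{u, v}) (N : Type w) [L.Structure N] (κ : Cardinal.{w}) : Prop :=
  ∀ C : Set N, #C < κ → ∀ (k : ℕ) (p : Set (L[[C]].Formula (Fin k))),
    (∀ q : Finset (L[[C]].Formula (Fin k)), (q : Set (L[[C]].Formula (Fin k))) ⊆ p →
      ∃ v : Fin k → N, ∀ φ ∈ q, φ.Realize v) →
    ∃ v : Fin k → N, ∀ φ ∈ p, φ.Realize v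

/-- `N` is strongly `κ`-homogeneous: every elementary map between subsets of `N` of size less
than `κ` extends to an automorphism. -/
def IsStronglyHomogeneous (L : FirstOrder.Language.{u, v}) (N : Type w) [L.Structure N]
    (κ : Cardinal.{w}) : Prop :=
  ∀ C : Set N, #C < κ → ∀ f : C → N,
    (∀ φ : L.Formula C, φ.Realize (fun c : C => (c : N)) ↔ φ.Realize f) →
    ∃ σ : N ≃[L] N, ∀ c : C, σ c = f c

/-- `N` is a monster model of degree `κ`: it is `κ`-saturated and strongly `κ`-homogeneous for an
uncountable strong limit cardinal `κ` greater than the size of the language. `Small` and `bounded`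
then mean `of cardinality less than κ`. -/
structure IsMonster (L : FirstOrder.Language.{u, v}) (N : Type w) [L.Structure N] (κ : Cardinal.{w}) :
    Prop where
  strongLimit : κ.IsStrongLimit
  uncountable : ℵ₀ < κ
  card_lt : Cardinal.lift.{w} L.card < Cardinal.lift.{max u v} κ
  saturated : IsSaturated L N κ
  homogeneous : IsStronglyHomogeneous L N κ

/-! ### Invariant and type-definable sets, and connected components

`X` is a set whose elements `x` are (coded by) tuples `c x` of elements of `N`. -/

section Components

variable (L : FirstOrder.Language.{u, v}) {N : Type w} [L.Structure N] {α : Type*} {X : Type*}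

/-- `S ⊆ X` is invariant under the automorphisms of `N` which fix `B` pointwise. -/
def IsInvariant (c : X → α → N) (B : Set N) (S : Set X) : Prop :=
  ∀ σ : N ≃[L] N, (∀ b ∈ B, σ b = b) → ∀ x y : X, (c y = fun i => σ (c x i)) → x ∈ S → y ∈ S

/-- `S ⊆ X` is type-definable over `B`: it is an intersection of `B`-definable sets. -/
def IsTypeDefinable (c : X → α → N) (B : Set N) (S : Set X) : Prop :=
  ∃ F : Set (Set (α → N)), (∀ D ∈ F, B.Definable L D) ∧ c '' S = ⋂₀ F

variable {G : Type w} [Group G]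

/-- `G^{000}_B`: the smallest `B`-invariant subgroup of `G` of bounded index, that is, the
intersection of all of them. -/
def comp000 (c : G → α → N) (B : Set N) (κ : Cardinal.{w}) : Subgroup G :=
  sInf {H | IsInvariant L c B (H : Set G) ∧ #(G ⧸ H) < κ}

/-- `G^{00}_B`: the smallest subgroup of `G` of bounded index which is type-definable over `B`,
that is, the intersection of all of them. -/
def comp00 (c : G → α → N) (B : Set N) (κ : Cardinal.{w}) : Subgroup G :=
  sInf {H | IsTypeDefinable L c B (H : Set G) ∧ #(G ⧸ H) < κ}

end Components

/-! ### The interpretation of a definable set in an elementary extension -/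

section Interp

variable {L : FirstOrder.Language.{u, v}} {M : Type w} {N : Type w'} [L.Structure M] [L.Structure N]
  {α β : Type}

/-- The formula `φ` with parameters from `M` defines `X` in `M`. -/
def Defines (φ : L.Formula (M ⊕ α)) (X : Set (α → M)) : Prop :=
  ∀ v, v ∈ X ↔ φ.Realize (Sum.elim id v)

/-- The interpretation in `N` of a set `X` which is definable in `M`, where `e : M → N` is an
elementary embedding: it is the set defined in `N` by any formula that defines `X` in `M`
(see `mem_interp`). -/
def interp (e : M ↪ₑ[L] N) (X : Set (α → M)) : Set (α → N) :=
  {v | ∃ φ : L.Formula (M ⊕ α), Defines φ X ∧ φ.Realize (Sum.elim e v)}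

theorem exists_defines {B : Set M} {X : Set (α → M)} (h : B.Definable L X) :
    ∃ φ : L.Formula (M ⊕ α), Defines φ X := by
  obtain ⟨φ, rfl⟩ := Set.definable_iff_exists_formula_sum.1 h
  refine ⟨φ.relabel (Sum.map (fun b : B => (b : M)) id), fun v => ?_⟩
  simp only [Set.mem_ofPred_eq, FirstOrder.Language.Formula.realize_relabel]
  rw [show (Sum.elim id v ∘ Sum.map (fun b : B => (b : M)) id : B ⊕ α → M)
    = Sum.elim (fun b : B => (b : M)) v by
      funext i; rcases i with i | i <;> rfl]

theorem realize_transfer (e : M ↪ₑ[L] N) [Finite α] {φ : L.Formula (M ⊕ α)}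
    (h : ∀ v : α → M, φ.Realize (Sum.elim id v)) (v : α → N) : φ.Realize (Sum.elim e v) := by
  have h1 : (φ.iAlls α).Realize (id : M → M) := FirstOrder.Language.Formula.realize_iAlls.2 h
  have h2 := (e.map_formula _ _).2 h1
  exact FirstOrder.Language.Formula.realize_iAlls.1 h2 v

theorem interp_mono (e : M ↪ₑ[L] N) [Finite α] {X Y : Set (α → M)} {φ ψ : L.Formula (M ⊕ α)}
    (hφ : Defines φ X) (hψ : Defines ψ Y) (hXY : X ⊆ Y) {v : α → N}
    (hv : φ.Realize (Sum.elim e v)) : ψ.Realize (Sum.elim e v) := by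
  have := realize_transfer e (φ := φ.imp ψ) (fun v => by
    rw [FirstOrder.Language.Formula.realize_imp]
    exact fun h => (hψ v).1 (hXY ((hφ v).2 h))) v
  exact FirstOrder.Language.Formula.realize_imp.1 this hv

theorem mem_interp (e : M ↪ₑ[L] N) [Finite α] {X : Set (α → M)} {φ : L.Formula (M ⊕ α)}
    (hφ : Defines φ X) {v : α → N} : v ∈ interp e X ↔ φ.Realize (Sum.elim e v) :=
  ⟨fun ⟨_, hψ, h⟩ => interp_mono e hψ hφ subset_rfl h, fun h => ⟨φ, hφ, h⟩⟩

theorem mem_interp_comp (e : M ↪ₑ[L] N) [Finite α] {B : Set M} {X : Set (α → M)}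
    (hX : B.Definable L X) {v : α → M} : (e ∘ v) ∈ interp e X ↔ v ∈ X := by
  obtain ⟨φ, hφ⟩ := exists_defines hX
  rw [mem_interp e hφ, hφ v, ← e.map_formula]
  rw [Sum.comp_elim]
  rfl

/-- The condition that the subtuple `v ∘ r` of a tuple `v` lies in the definable set `X`. -/
structure Atom (L : FirstOrder.Language.{u, v}) (M : Type w) [L.Structure M] (β : Type) where
  γ : Type
  fin : Finite γ
  r : γ → β
  X : Set (γ → M)
  definable : ∃ φ : L.Formula (M ⊕ γ), Defines φ X

theorem exists_defines_atoms (l : List (Atom L M β)) :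
    ∃ φ : L.Formula (M ⊕ β), (∀ v : β → M,
      (φ.Realize (Sum.elim id v) ↔ ∀ a ∈ l, v ∘ a.r ∈ a.X)) ∧
      ∀ (e : M ↪ₑ[L] N) (v : β → N),
        (φ.Realize (Sum.elim e v) ↔ ∀ a ∈ l, v ∘ a.r ∈ interp e a.X) := by
  induction l with
  | nil => exact ⟨⊤, by simp, by simp⟩
  | cons a l ih =>
    obtain ⟨φ, h1, h2⟩ := ih
    obtain ⟨ψ, hψ⟩ := a.definable
    have := a.fin
    refine ⟨(ψ.relabel (Sum.map id a.r)) ⊓ φ, fun v => ?_, fun e v => ?_⟩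
    · rw [FirstOrder.Language.Formula.realize_inf, FirstOrder.Language.Formula.realize_relabel, h1,
        List.forall_mem_cons, hψ, Sum.elim_comp_map]
      rfl
    · rw [FirstOrder.Language.Formula.realize_inf, FirstOrder.Language.Formula.realize_relabel, h2,
        List.forall_mem_cons, mem_interp e hψ, Sum.elim_comp_map]
      rfl

theorem horn (e : M ↪ₑ[L] N) [Finite β] (l : List (Atom L M β)) (a : Atom L M β)
    (h : ∀ v : β → M, (∀ b ∈ l, v ∘ b.r ∈ b.X) → v ∘ a.r ∈ a.X) (v : β → N)
    (hv : ∀ b ∈ l, v ∘ b.r ∈ interp e b.X) : v ∘ a.r ∈ interp e a.X := by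
  obtain ⟨φ, h1, h2⟩ := exists_defines_atoms (N := N) l
  obtain ⟨ψ, h3, h4⟩ := exists_defines_atoms (N := N) [a]
  have := (h4 e v).1 (interp_mono e (X := {v | ∀ b ∈ l, v ∘ b.r ∈ b.X})
    (Y := {v | ∀ b ∈ [a], v ∘ b.r ∈ b.X}) (fun v => (h1 v).symm) (fun v => (h3 v).symm)
    (fun v hv => by simpa using h v hv) ((h2 e v).2 hv))
  simpa using this

/-- Transfer of the existence of a further tuple. -/
theorem transfer_exists (e : M ↪ₑ[L] N) {γ : Type} [Finite β] [Finite γ]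
    (l : List (Atom L M β)) (a : Atom L M (β ⊕ γ))
    (h : ∀ v : β → M, (∀ b ∈ l, v ∘ b.r ∈ b.X) → ∃ t : γ → M, Sum.elim v t ∘ a.r ∈ a.X)
    (v : β → N) (hv : ∀ b ∈ l, v ∘ b.r ∈ interp e b.X) :
    ∃ t : γ → N, Sum.elim v t ∘ a.r ∈ interp e a.X := by
  obtain ⟨φ, h1, h2⟩ := exists_defines_atoms (N := N) l
  obtain ⟨ψ, h3, h4⟩ := exists_defines_atoms (N := N) [a]
  let χ : L.Formula (M ⊕ β) :=
    FirstOrder.Language.Formula.iExs γ (ψ.relabel (Equiv.sumAssoc M β γ).symm)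
  have key : ∀ (f : M → M) (v : β → M) (t : γ → M),
      (Sum.elim (Sum.elim f v) t) ∘ (Equiv.sumAssoc M β γ).symm = Sum.elim f (Sum.elim v t) := by
    intro f v t; funext i; rcases i with i | i | i <;> rfl
  have key' : ∀ (f : M → N) (v : β → N) (t : γ → N),
      (Sum.elim (Sum.elim f v) t) ∘ (Equiv.sumAssoc M β γ).symm = Sum.elim f (Sum.elim v t) := by
    intro f v t; funext i; rcases i with i | i | i <;> rfl
  have hχ : Defines χ {v | ∃ t : γ → M, Sum.elim v t ∘ a.r ∈ a.X} := by
    intro v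
    simp only [Set.mem_ofPred_eq, χ, FirstOrder.Language.Formula.realize_iExs,
      FirstOrder.Language.Formula.realize_relabel, key, h3, List.mem_singleton, forall_eq]
  have := interp_mono e (X := {v | ∀ b ∈ l, v ∘ b.r ∈ b.X}) (fun v => (h1 v).symm) hχ
    (fun v hv => h v hv) ((h2 e v).2 hv)
  simpa only [Set.mem_ofPred_eq, χ, FirstOrder.Language.Formula.realize_iExs,
      FirstOrder.Language.Formula.realize_relabel, key', h4, List.mem_singleton, forall_eq] using this

theorem interp_finite (e : M ↪ₑ[L] N) [Finite α] {X : Set (α → M)} (hX : X.Finite) :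
    (∃ φ : L.Formula (M ⊕ α), Defines φ X) ∧ ∀ v ∈ interp e X, ∃ x ∈ X, v = e ∘ x := by
  have := hX.to_subtype
  let t : X → α → L.Formula (M ⊕ α) := fun x i =>
    FirstOrder.Language.Term.equal (FirstOrder.Language.Term.var (Sum.inr i))
      (FirstOrder.Language.Term.var (Sum.inl (x.1 i)))
  let φ : L.Formula (M ⊕ α) :=
    FirstOrder.Language.Formula.iSup fun x : X => FirstOrder.Language.Formula.iInf (t x)
  have h1 : Defines φ X := by
    intro v
    simp only [φ, t, FirstOrder.Language.Formula.realize_iSup,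
      FirstOrder.Language.Formula.realize_iInf, FirstOrder.Language.Formula.realize_equal,
      FirstOrder.Language.Term.realize_var, Sum.elim_inr, Sum.elim_inl, id]
    exact ⟨fun h => ⟨⟨v, h⟩, fun _ => rfl⟩, fun ⟨x, hx⟩ => by rw [funext hx]; exact x.2⟩
  refine ⟨⟨φ, h1⟩, fun v hv => ?_⟩
  rw [mem_interp e h1] at hv
  simp only [φ, t, FirstOrder.Language.Formula.realize_iSup,
    FirstOrder.Language.Formula.realize_iInf, FirstOrder.Language.Formula.realize_equal,
    FirstOrder.Language.Term.realize_var, Sum.elim_inr, Sum.elim_inl] at hv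
  obtain ⟨x, hx⟩ := hv
  exact ⟨x, x.2, funext hx⟩

end Interp

/-! ### Interpretation of definable binary functions -/

section Star

variable {L : FirstOrder.Language.{u, v}} {M : Type w} {N : Type w'} [L.Structure M]
  [L.Structure N] {X Y Z : Type*} {a b c : ℕ}

/-- The graph of a binary function `f : X → Y → Z`, where elements of `X`, `Y`, `Z` are coded by
tuples of elements of `M`. -/
def graph₂ (cX : X → Fin a → M) (cY : Y → Fin b → M) (cZ : Z → Fin c → M) (f : X → Y → Z) :
    Set (Fin a ⊕ Fin b ⊕ Fin c → M) :=
  Set.range fun p : X × Y => Sum.elim (cX p.1) (Sum.elim (cY p.2) (cZ (f p.1 p.2)))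

theorem mem_graph₂ {cX : X → Fin a → M} {cY : Y → Fin b → M} {cZ : Z → Fin c → M}
    {f : X → Y → Z} {u : Fin a → M} {v : Fin b → M} {t : Fin c → M} :
    Sum.elim u (Sum.elim v t) ∈ graph₂ cX cY cZ f ↔
      ∃ x y, cX x = u ∧ cY y = v ∧ cZ (f x y) = t := by
  constructor
  · rintro ⟨⟨x, y⟩, h⟩
    refine ⟨x, y, funext fun i => congrFun h (Sum.inl i),
      funext fun i => congrFun h (Sum.inr (Sum.inl i)),
      funext fun i => congrFun h (Sum.inr (Sum.inr i))⟩
  · rintro ⟨x, y, rfl, rfl, rfl⟩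
    exact ⟨(x, y), rfl⟩

/-- The interpretation `X*` in `N` of the definable set `X`. -/
def Star (e : M ↪ₑ[L] N) (cX : X → Fin a → M) : Type w' :=
  {v : Fin a → N // v ∈ interp e (Set.range cX)}

/-- Any two elements of `X*` and `Y*` have a unique image under the interpretation of `f`. -/
theorem existsUnique_star (e : M ↪ₑ[L] N) {B₁ B₂ B₃ B₄ : Set M}
    {cX : X → Fin a → M} {cY : Y → Fin b → M} {cZ : Z → Fin c → M} {f : X → Y → Z}
    (iX : cX.Injective) (iY : cY.Injective)
    (dX : B₁.Definable L (Set.range cX)) (dY : B₂.Definable L (Set.range cY))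
    (dZ : B₃.Definable L (Set.range cZ)) (df : B₄.Definable L (graph₂ cX cY cZ f))
    (x : Star e cX) (y : Star e cY) :
    ∃! z : Star e cZ, Sum.elim x.1 (Sum.elim y.1 z.1) ∈ interp e (graph₂ cX cY cZ f) := by
  have ex := transfer_exists e (β := Fin a ⊕ Fin b) (γ := Fin c)
    [⟨Fin a, inferInstance, Sum.inl, _, exists_defines dX⟩,
      ⟨Fin b, inferInstance, Sum.inr, _, exists_defines dY⟩]
    ⟨Fin a ⊕ Fin b ⊕ Fin c, inferInstance, (Equiv.sumAssoc _ _ _).symm, _, exists_defines df⟩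
    (by
      intro v hv
      simp only [List.forall_mem_cons] at hv
      obtain ⟨⟨x, hx⟩, ⟨y, hy⟩, -⟩ := hv
      refine ⟨cZ (f x y), (x, y), ?_⟩
      funext i
      rcases i with i | i | i
      · exact congrFun hx i
      · exact congrFun hy i
      · rfl)
    (Sum.elim x.1 y.1) (by
      simp only [List.forall_mem_cons]
      exact ⟨x.2, y.2, by simp⟩)
  obtain ⟨t, ht⟩ := ex
  have key : ∀ (p : Fin a → N) (q : Fin b → N) (t : Fin c → N),
      Sum.elim (Sum.elim p q) t ∘ (Equiv.sumAssoc (Fin a) (Fin b) (Fin c)).symm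
        = Sum.elim p (Sum.elim q t) := by
    intro p q t; funext i; rcases i with i | i | i <;> rfl
  simp only [key] at ht
  have htZ : t ∈ interp e (Set.range cZ) :=
    horn e (β := Fin a ⊕ Fin b ⊕ Fin c)
      [⟨_, inferInstance, id, _, exists_defines df⟩]
      ⟨Fin c, inferInstance, Sum.inr ∘ Sum.inr, _, exists_defines dZ⟩
      (by
        intro v hv
        obtain ⟨⟨x, y⟩, h⟩ := hv _ (List.mem_singleton_self _)
        exact ⟨f x y, funext fun i => congrFun h (Sum.inr (Sum.inr i))⟩)
      (Sum.elim x.1 (Sum.elim y.1 t)) (by simpa using ht)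
  refine ⟨⟨t, htZ⟩, ht, fun z hz => Subtype.ext ?_⟩
  have hdiag : ∃ φ : L.Formula (M ⊕ (Fin c ⊕ Fin c)),
      Defines φ {v | v ∘ Sum.inl = v ∘ Sum.inr} ∧
      ∀ v : Fin c ⊕ Fin c → N, φ.Realize (Sum.elim e v) → v ∘ Sum.inl = v ∘ Sum.inr := by
    refine ⟨FirstOrder.Language.Formula.iInf fun i : Fin c =>
      FirstOrder.Language.Term.equal (FirstOrder.Language.Term.var (Sum.inr (Sum.inl i)))
        (FirstOrder.Language.Term.var (Sum.inr (Sum.inr i))), fun v => ?_, fun v => ?_⟩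
    · simp [funext_iff, FirstOrder.Language.Formula.realize_iInf]
    · simp [funext_iff, FirstOrder.Language.Formula.realize_iInf]
  obtain ⟨φ, hφ, hφ'⟩ := hdiag
  have h := horn e (β := Fin a ⊕ Fin b ⊕ Fin c ⊕ Fin c)
      [⟨Fin a ⊕ Fin b ⊕ Fin c, inferInstance, Sum.map id (Sum.map id Sum.inl), _,
          exists_defines df⟩,
        ⟨Fin a ⊕ Fin b ⊕ Fin c, inferInstance, Sum.map id (Sum.map id Sum.inr), _,
          exists_defines df⟩]
      ⟨Fin c ⊕ Fin c, inferInstance, Sum.inr ∘ Sum.inr, _, ⟨φ, hφ⟩⟩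
      (by
        intro v hv
        simp only [List.forall_mem_cons] at hv
        obtain ⟨⟨⟨x, y⟩, h1⟩, ⟨⟨x', y'⟩, h2⟩, -⟩ := hv
        have hx : x = x' := iX (funext fun i =>
          (congrFun h1 (Sum.inl i)).trans (congrFun h2 (Sum.inl i)).symm)
        have hy : y = y' := iY (funext fun i =>
          (congrFun h1 (Sum.inr (Sum.inl i))).trans (congrFun h2 (Sum.inr (Sum.inl i))).symm)
        subst hx hy
        exact funext fun i =>
          (congrFun h1 (Sum.inr (Sum.inr i))).symm.trans (congrFun h2 (Sum.inr (Sum.inr i))))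
      (Sum.elim x.1 (Sum.elim y.1 (Sum.elim z.1 t))) (by
        simp only [List.forall_mem_cons, Sum.elim_comp_map, Function.comp_id, Sum.elim_comp_inl,
          Sum.elim_comp_inr]
        exact ⟨hz, ht, by simp⟩)
  exact hφ' _ ((mem_interp e hφ).1 h)

end Star

/-! ### The situation: a definable 2-cocycle with finite image -/

/-- `G` is a group acting by automorphisms on the abelian group `A`, where `G`, `A` and the action
are `∅`-definable in the structure `M`, and `h : G × G → A` is a 2-cocycle which is `B`-definable
in `M` and has finite image contained in `dcl(B)`, for a finite set `B` of parameters.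
Elements of `G` and `A` are identified with tuples of elements of `M` via `codeG` and `codeA`;
the sorts of a many-sorted structure are to be regarded as unary predicates on `M`. -/
structure Situation (L : FirstOrder.Language.{u, v}) (M : Type w) [L.Structure M]
    (G A : Type*) [Group G] [AddCommGroup A] [DistribMulAction G A] where
  n : ℕ
  m : ℕ
  codeG : G → Fin n → M
  codeA : A → Fin m → M
  codeG_injective : codeG.Injective
  codeA_injective : codeA.Injective
  definable_G : (∅ : Set M).Definable L (Set.range codeG)
  definable_A : (∅ : Set M).Definable L (Set.range codeA)
  definable_mul : (∅ : Set M).Definable L (graph₂ codeG codeG codeG fun x y => x * y)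
  definable_add : (∅ : Set M).Definable L (graph₂ codeA codeA codeA fun x y => x + y)
  definable_smul : (∅ : Set M).Definable L (graph₂ codeG codeA codeA fun x y => x • y)
  B : Set M
  finite_B : B.Finite
  h : FactorSet G A
  definable_h : B.Definable L (graph₂ codeG codeG codeA h.toFun)
  finite_im : (Set.range fun p : G × G => h.toFun p.1 p.2).Finite
  im_dcl : ∀ x y, B.Definable L {codeA (h.toFun x y)}

namespace Situation

variable {L : FirstOrder.Language.{u, v}} {M : Type w} {N : Type w'} [L.Structure M]
  [L.Structure N] {G A : Type*} [Group G] [AddCommGroup A] [DistribMulAction G A]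
  (S : Situation L M G A) (e : M ↪ₑ[L] N)

/-- `G*`, the interpretation of `G` in `N`. -/
def GStar : Type w' := Star e S.codeG

/-- `A*`, the interpretation of `A` in `N`. -/
def AStar : Type w' := Star e S.codeA

variable {e}

/-- The tuple of elements of `N` which an element of `G*` is. -/
def cG (x : S.GStar e) : Fin S.n → N := x.1

/-- The tuple of elements of `N` which an element of `A*` is. -/
def cA (a : S.AStar e) : Fin S.m → N := a.1

variable {S} in
theorem cG_injective : Function.Injective (S.cG (e := e)) := Subtype.val_injective

variable {S} in
theorem cA_injective : Function.Injective (S.cA (e := e)) := Subtype.val_injective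

variable (e)

/-- The interpretation of the multiplication of `G`: the function whose graph is the
interpretation of the graph. -/
noncomputable def mulStar (x y : S.GStar e) : S.GStar e :=
  (existsUnique_star e S.codeG_injective S.codeG_injective S.definable_G S.definable_G
    S.definable_G S.definable_mul x y).choose

/-- The interpretation of the addition of `A`. -/
noncomputable def addStar (x y : S.AStar e) : S.AStar e :=
  (existsUnique_star e S.codeA_injective S.codeA_injective S.definable_A S.definable_A
    S.definable_A S.definable_add x y).choose

/-- The interpretation of the action of `G` on `A`. -/
noncomputable def smulStar (x : S.GStar e) (y : S.AStar e) : S.AStar e :=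
  (existsUnique_star e S.codeG_injective S.codeA_injective S.definable_G S.definable_A
    S.definable_A S.definable_smul x y).choose

/-- The interpretation `h*` of the 2-cocycle `h`, as a function. -/
noncomputable def hFun (x y : S.GStar e) : S.AStar e :=
  (existsUnique_star e S.codeG_injective S.codeG_injective S.definable_G S.definable_G
    S.definable_A S.definable_h x y).choose

variable {e}

theorem mulStar_iff {x y z : S.GStar e} : S.mulStar e x y = z ↔
    Sum.elim (S.cG x) (Sum.elim (S.cG y) (S.cG z)) ∈
      interp e (graph₂ S.codeG S.codeG S.codeG fun x y => x * y) := by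
  have := (existsUnique_star e S.codeG_injective S.codeG_injective S.definable_G S.definable_G
    S.definable_G S.definable_mul x y)
  exact ⟨fun h => h ▸ this.choose_spec.1, fun h => (this.choose_spec.2 z h).symm⟩

theorem addStar_iff {x y z : S.AStar e} : S.addStar e x y = z ↔
    Sum.elim (S.cA x) (Sum.elim (S.cA y) (S.cA z)) ∈
      interp e (graph₂ S.codeA S.codeA S.codeA fun x y => x + y) := by
  have := (existsUnique_star e S.codeA_injective S.codeA_injective S.definable_A S.definable_A
    S.definable_A S.definable_add x y)
  exact ⟨fun h => h ▸ this.choose_spec.1, fun h => (this.choose_spec.2 z h).symm⟩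

theorem smulStar_iff {x : S.GStar e} {y z : S.AStar e} : S.smulStar e x y = z ↔
    Sum.elim (S.cG x) (Sum.elim (S.cA y) (S.cA z)) ∈
      interp e (graph₂ S.codeG S.codeA S.codeA fun x y => x • y) := by
  have := (existsUnique_star e S.codeG_injective S.codeA_injective S.definable_G S.definable_A
    S.definable_A S.definable_smul x y)
  exact ⟨fun h => h ▸ this.choose_spec.1, fun h => (this.choose_spec.2 z h).symm⟩

theorem hFun_iff {x y : S.GStar e} {z : S.AStar e} : S.hFun e x y = z ↔
    Sum.elim (S.cG x) (Sum.elim (S.cG y) (S.cA z)) ∈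
      interp e (graph₂ S.codeG S.codeG S.codeA S.h.toFun) := by
  have := (existsUnique_star e S.codeG_injective S.codeG_injective S.definable_G S.definable_G
    S.definable_A S.definable_h x y)
  exact ⟨fun h => h ▸ this.choose_spec.1, fun h => (this.choose_spec.2 z h).symm⟩

variable (e)

/-- The inclusion `G ⊆ G*`. -/
def embG (x : G) : S.GStar e :=
  ⟨e ∘ S.codeG x, (mem_interp_comp e S.definable_G).2 ⟨x, rfl⟩⟩

/-- The inclusion `A ⊆ A*`. -/
def embA (a : A) : S.AStar e :=
  ⟨e ∘ S.codeA a, (mem_interp_comp e S.definable_A).2 ⟨a, rfl⟩⟩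

theorem mulStar_emb (x y : G) : S.mulStar e (S.embG e x) (S.embG e y) = S.embG e (x * y) := by
  rw [mulStar_iff]
  have := (mem_interp_comp e S.definable_mul).2
    (mem_graph₂.2 ⟨x, y, rfl, rfl, rfl⟩)
  rwa [Sum.comp_elim, Sum.comp_elim] at this

theorem addStar_emb (x y : A) : S.addStar e (S.embA e x) (S.embA e y) = S.embA e (x + y) := by
  rw [addStar_iff]
  have := (mem_interp_comp e S.definable_add).2
    (mem_graph₂.2 ⟨x, y, rfl, rfl, rfl⟩)
  rwa [Sum.comp_elim, Sum.comp_elim] at this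

theorem smulStar_emb (x : G) (y : A) :
    S.smulStar e (S.embG e x) (S.embA e y) = S.embA e (x • y) := by
  rw [smulStar_iff]
  have := (mem_interp_comp e S.definable_smul).2
    (mem_graph₂.2 ⟨x, y, rfl, rfl, rfl⟩)
  rwa [Sum.comp_elim, Sum.comp_elim] at this

theorem hFun_emb (x y : G) :
    S.hFun e (S.embG e x) (S.embG e y) = S.embA e (S.h.toFun x y) := by
  rw [hFun_iff]
  have := (mem_interp_comp e S.definable_h).2
    (mem_graph₂.2 ⟨x, y, rfl, rfl, rfl⟩)
  rwa [Sum.comp_elim, Sum.comp_elim] at this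

/-! Transfer of the laws from `M` to `N`, by means of six variables ranging over `G` and six
variables ranging over `A`. -/

/-- The coordinates of six elements of `G` and of six elements of `A`. -/
abbrev Vars : Type := (Fin 6 × Fin S.n) ⊕ (Fin 6 × Fin S.m)

/-- The `i`-th variable of `G`. -/
def gv (i : Fin 6) : Fin S.n → S.Vars := fun t => Sum.inl (i, t)

/-- The `i`-th variable of `A`. -/
def av (i : Fin 6) : Fin S.m → S.Vars := fun t => Sum.inr (i, t)

/-- The condition that the `i`-th variable of `G` lies in `G`. -/
def domGAt (i : Fin 6) : Atom L M S.Vars :=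
  ⟨Fin S.n, inferInstance, S.gv i, _, exists_defines S.definable_G⟩

/-- The condition that the `i`-th variable of `A` lies in `A`. -/
def domAAt (i : Fin 6) : Atom L M S.Vars :=
  ⟨Fin S.m, inferInstance, S.av i, _, exists_defines S.definable_A⟩

/-- The condition `x i * x j = x k`. -/
def mulAt (i j k : Fin 6) : Atom L M S.Vars :=
  ⟨Fin S.n ⊕ Fin S.n ⊕ Fin S.n, inferInstance, Sum.elim (S.gv i) (Sum.elim (S.gv j) (S.gv k)), _,
    exists_defines S.definable_mul⟩

/-- The condition `a i + a j = a k`. -/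
def addAt (i j k : Fin 6) : Atom L M S.Vars :=
  ⟨Fin S.m ⊕ Fin S.m ⊕ Fin S.m, inferInstance, Sum.elim (S.av i) (Sum.elim (S.av j) (S.av k)), _,
    exists_defines S.definable_add⟩

/-- The condition `x i • a j = a k`. -/
def smulAt (i j k : Fin 6) : Atom L M S.Vars :=
  ⟨Fin S.n ⊕ Fin S.m ⊕ Fin S.m, inferInstance, Sum.elim (S.gv i) (Sum.elim (S.av j) (S.av k)), _,
    exists_defines S.definable_smul⟩

/-- The condition `h (x i, x j) = a k`. -/
def hAt (i j k : Fin 6) : Atom L M S.Vars :=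
  ⟨Fin S.n ⊕ Fin S.n ⊕ Fin S.m, inferInstance, Sum.elim (S.gv i) (Sum.elim (S.gv j) (S.av k)), _,
    exists_defines S.definable_h⟩

/-- The values in `M` of the variables satisfy the condition `t`. -/
def Holds (t : Atom L M S.Vars) (v : S.Vars → M) : Prop := v ∘ t.r ∈ t.X

theorem domGAt_iff {i : Fin 6} {v : S.Vars → M} :
    S.Holds (S.domGAt i) v ↔ ∃ x, S.codeG x = v ∘ S.gv i := Iff.rfl

theorem domAAt_iff {i : Fin 6} {v : S.Vars → M} :
    S.Holds (S.domAAt i) v ↔ ∃ x, S.codeA x = v ∘ S.av i := Iff.rfl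

theorem mulAt_iff {i j k : Fin 6} {v : S.Vars → M} : S.Holds (S.mulAt i j k) v ↔
    ∃ x y, S.codeG x = v ∘ S.gv i ∧ S.codeG y = v ∘ S.gv j ∧ S.codeG (x * y) = v ∘ S.gv k := by
  simp only [Holds, mulAt, Sum.comp_elim]
  exact mem_graph₂

theorem addAt_iff {i j k : Fin 6} {v : S.Vars → M} : S.Holds (S.addAt i j k) v ↔
    ∃ x y, S.codeA x = v ∘ S.av i ∧ S.codeA y = v ∘ S.av j ∧ S.codeA (x + y) = v ∘ S.av k := by
  simp only [Holds, addAt, Sum.comp_elim]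
  exact mem_graph₂

theorem smulAt_iff {i j k : Fin 6} {v : S.Vars → M} : S.Holds (S.smulAt i j k) v ↔
    ∃ x y, S.codeG x = v ∘ S.gv i ∧ S.codeA y = v ∘ S.av j ∧ S.codeA (x • y) = v ∘ S.av k := by
  simp only [Holds, smulAt, Sum.comp_elim]
  exact mem_graph₂

theorem hAt_iff {i j k : Fin 6} {v : S.Vars → M} : S.Holds (S.hAt i j k) v ↔
    ∃ x y, S.codeG x = v ∘ S.gv i ∧ S.codeG y = v ∘ S.gv j ∧
      S.codeA (S.h.toFun x y) = v ∘ S.av k := by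
  simp only [Holds, hAt, Sum.comp_elim]
  exact mem_graph₂

variable {e}

/-- The values in `N` of the variables. -/
def env (x : Fin 6 → S.GStar e) (a : Fin 6 → S.AStar e) : S.Vars → N :=
  Sum.elim (fun p => S.cG (x p.1) p.2) (fun p => S.cA (a p.1) p.2)

/-- The values in `N` of the variables satisfy the condition `t`. -/
def HoldsStar (t : Atom L M S.Vars) (x : Fin 6 → S.GStar e) (a : Fin 6 → S.AStar e) : Prop :=
  S.env x a ∘ t.r ∈ interp e t.X

theorem env_gv (x : Fin 6 → S.GStar e) (a : Fin 6 → S.AStar e) (i : Fin 6) :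
    S.env x a ∘ S.gv i = S.cG (x i) := rfl

theorem env_av (x : Fin 6 → S.GStar e) (a : Fin 6 → S.AStar e) (i : Fin 6) :
    S.env x a ∘ S.av i = S.cA (a i) := rfl

variable {x : Fin 6 → S.GStar e} {a : Fin 6 → S.AStar e} {i j k : Fin 6}

theorem domGAt_star : S.HoldsStar (S.domGAt i) x a := (x i).2

theorem domAAt_star : S.HoldsStar (S.domAAt i) x a := (a i).2

theorem mulAt_star : S.HoldsStar (S.mulAt i j k) x a ↔ S.mulStar e (x i) (x j) = x k := by
  rw [mulStar_iff]; simp only [HoldsStar, mulAt, Sum.comp_elim, env_gv]; exact Iff.rfl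

theorem addAt_star : S.HoldsStar (S.addAt i j k) x a ↔ S.addStar e (a i) (a j) = a k := by
  rw [addStar_iff]; simp only [HoldsStar, addAt, Sum.comp_elim, env_av]; exact Iff.rfl

theorem smulAt_star : S.HoldsStar (S.smulAt i j k) x a ↔ S.smulStar e (x i) (a j) = a k := by
  rw [smulStar_iff]; simp only [HoldsStar, smulAt, Sum.comp_elim, env_gv, env_av]; exact Iff.rfl

theorem hAt_star : S.HoldsStar (S.hAt i j k) x a ↔ S.hFun e (x i) (x j) = a k := by
  rw [hFun_iff]; simp only [HoldsStar, hAt, Sum.comp_elim, env_gv, env_av]; exact Iff.rfl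

theorem horn_star (l : List (Atom L M S.Vars)) (t : Atom L M S.Vars)
    (h : ∀ v : S.Vars → M, (∀ b ∈ l, S.Holds b v) → S.Holds t v)
    (x : Fin 6 → S.GStar e) (a : Fin 6 → S.AStar e)
    (hv : ∀ b ∈ l, S.HoldsStar b x a) : S.HoldsStar t x a :=
  horn e l t h (S.env x a) hv

theorem mulStar_assoc (x y z : S.GStar e) :
    S.mulStar e (S.mulStar e x y) z = S.mulStar e x (S.mulStar e y z) := by
  have := S.horn_star [S.mulAt 0 1 3, S.mulAt 3 2 4, S.mulAt 1 2 5] (S.mulAt 0 5 4) (by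
      intro v hv
      simp only [List.forall_mem_cons, mulAt_iff] at hv ⊢
      obtain ⟨⟨x, y, h0, h1, h3⟩, ⟨w, z, h3', h2, h4⟩, ⟨y', z', h1', h2', h5⟩, -⟩ := hv
      obtain rfl := S.codeG_injective (h3.trans h3'.symm)
      obtain rfl := S.codeG_injective (h1.trans h1'.symm)
      obtain rfl := S.codeG_injective (h2.trans h2'.symm)
      exact ⟨x, y * z, h0, h5, by rw [← mul_assoc]; exact h4⟩)
    ![x, y, z, S.mulStar e x y, S.mulStar e (S.mulStar e x y) z, S.mulStar e y z]
    (fun _ => S.embA e 0) (by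
      simp only [List.forall_mem_cons, mulAt_star]
      exact ⟨rfl, rfl, rfl, by simp⟩)
  exact ((S.mulAt_star).1 this).symm

theorem one_mulStar (x : S.GStar e) : S.mulStar e (S.embG e 1) x = x := by
  have := S.horn_star [S.mulAt 0 0 0, S.domGAt 1] (S.mulAt 0 1 1) (by
      intro v hv
      simp only [List.forall_mem_cons, mulAt_iff, domGAt_iff] at hv ⊢
      obtain ⟨⟨x, y, h0, h1, h2⟩, ⟨z, h3⟩, -⟩ := hv
      obtain rfl := S.codeG_injective (h0.trans h1.symm)
      have hx : x = 1 := by simpa using S.codeG_injective (h2.trans h1.symm)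
      exact ⟨x, z, h0, h3, by rw [hx, one_mul, h3]⟩)
    ![S.embG e 1, x, x, x, x, x] (fun _ => S.embA e 0) (by
      simp only [List.forall_mem_cons, mulAt_star, domGAt_star, true_and]
      exact ⟨by simpa using S.mulStar_emb e 1 1, by simp⟩)
  exact (S.mulAt_star).1 this

theorem exists_inv (x : S.GStar e) : ∃ y, S.mulStar e y x = S.embG e 1 := by
  obtain ⟨t, ht⟩ := transfer_exists e (γ := Fin S.n) [S.domGAt 0, S.mulAt 1 1 1]
    ⟨Fin S.n ⊕ Fin S.n ⊕ Fin S.n, inferInstance,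
      Sum.elim Sum.inr (Sum.elim (Sum.inl ∘ S.gv 0) (Sum.inl ∘ S.gv 1)), _,
      exists_defines S.definable_mul⟩
    (by
      intro v hv
      change ∀ b ∈ _, S.Holds b v at hv
      simp only [List.forall_mem_cons, mulAt_iff, domGAt_iff] at hv
      obtain ⟨⟨z, h3⟩, ⟨x, y, h0, h1, h2⟩, -⟩ := hv
      obtain rfl := S.codeG_injective (h0.trans h1.symm)
      have hx : x = 1 := by simpa using S.codeG_injective (h2.trans h1.symm)
      refine ⟨S.codeG z⁻¹, ?_⟩
      simp only [Sum.comp_elim, Sum.elim_comp_inr, ← Function.comp_assoc, Sum.elim_comp_inl]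
      exact mem_graph₂.2 ⟨z⁻¹, z, rfl, h3, by rw [inv_mul_cancel, ← hx, h0]⟩)
    (S.env ![x, S.embG e 1, x, x, x, x] (fun _ => S.embA e 0)) (by
      change ∀ b ∈ _, S.HoldsStar b _ _
      simp only [List.forall_mem_cons, mulAt_star, domGAt_star, true_and]
      exact ⟨by simpa using S.mulStar_emb e 1 1, by simp⟩)
  simp only [Sum.comp_elim, Sum.elim_comp_inr, ← Function.comp_assoc, Sum.elim_comp_inl,
    env_gv] at ht
  have htG : t ∈ interp e (Set.range S.codeG) :=
    horn e (β := Fin S.n ⊕ Fin S.n ⊕ Fin S.n)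
      [⟨_, inferInstance, id, _, exists_defines S.definable_mul⟩]
      ⟨Fin S.n, inferInstance, Sum.inl, _, exists_defines S.definable_G⟩
      (by
        intro v hv
        obtain ⟨⟨x, y⟩, h⟩ := hv _ (List.mem_singleton_self _)
        exact ⟨x, funext fun i => congrFun h (Sum.inl i)⟩)
      (Sum.elim t (Sum.elim (S.cG x) (S.cG (S.embG e 1)))) (by simpa using ht)
  exact ⟨⟨t, htG⟩, S.mulStar_iff.2 ht⟩

/-- The group `G*`. -/
noncomputable instance : Group (S.GStar e) :=
  letI : Mul (S.GStar e) := ⟨S.mulStar e⟩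
  letI : One (S.GStar e) := ⟨S.embG e 1⟩
  letI : Inv (S.GStar e) := ⟨fun x => (S.exists_inv x).choose⟩
  Group.ofLeftAxioms S.mulStar_assoc S.one_mulStar fun x => (S.exists_inv x).choose_spec

theorem addStar_assoc (x y z : S.AStar e) :
    S.addStar e (S.addStar e x y) z = S.addStar e x (S.addStar e y z) := by
  have := S.horn_star [S.addAt 0 1 3, S.addAt 3 2 4, S.addAt 1 2 5] (S.addAt 0 5 4) (by
      intro v hv
      simp only [List.forall_mem_cons, addAt_iff] at hv ⊢
      obtain ⟨⟨x, y, h0, h1, h3⟩, ⟨w, z, h3', h2, h4⟩, ⟨y', z', h1', h2', h5⟩, -⟩ := hv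
      obtain rfl := S.codeA_injective (h3.trans h3'.symm)
      obtain rfl := S.codeA_injective (h1.trans h1'.symm)
      obtain rfl := S.codeA_injective (h2.trans h2'.symm)
      exact ⟨x, y + z, h0, h5, by rw [← add_assoc]; exact h4⟩)
    (fun _ => S.embG e 1)
    ![x, y, z, S.addStar e x y, S.addStar e (S.addStar e x y) z, S.addStar e y z] (by
      simp only [List.forall_mem_cons, addAt_star]
      exact ⟨rfl, rfl, rfl, by simp⟩)
  exact ((S.addAt_star).1 this).symm

theorem addStar_comm (x y : S.AStar e) : S.addStar e x y = S.addStar e y x := by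
  have := S.horn_star [S.addAt 0 1 2] (S.addAt 1 0 2) (by
      intro v hv
      simp only [List.forall_mem_cons, addAt_iff] at hv ⊢
      obtain ⟨⟨x, y, h0, h1, h3⟩, -⟩ := hv
      exact ⟨y, x, h1, h0, by rw [add_comm]; exact h3⟩)
    (fun _ => S.embG e 1)
    ![x, y, S.addStar e x y, x, x, x] (by
      simp only [List.forall_mem_cons, addAt_star]
      exact ⟨rfl, by simp⟩)
  exact ((S.addAt_star).1 this).symm

theorem zero_addStar (x : S.AStar e) : S.addStar e (S.embA e 0) x = x := by
  have := S.horn_star [S.addAt 0 0 0, S.domAAt 1] (S.addAt 0 1 1) (by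
      intro v hv
      simp only [List.forall_mem_cons, addAt_iff, domAAt_iff] at hv ⊢
      obtain ⟨⟨x, y, h0, h1, h2⟩, ⟨z, h3⟩, -⟩ := hv
      obtain rfl := S.codeA_injective (h0.trans h1.symm)
      have hx : x = 0 := by simpa using S.codeA_injective (h2.trans h1.symm)
      exact ⟨x, z, h0, h3, by rw [hx, zero_add, h3]⟩)
    (fun _ => S.embG e 1) ![S.embA e 0, x, x, x, x, x] (by
      simp only [List.forall_mem_cons, addAt_star, domAAt_star, true_and]
      exact ⟨by simpa using S.addStar_emb e 0 0, by simp⟩)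
  exact (S.addAt_star).1 this

theorem exists_neg (x : S.AStar e) : ∃ y, S.addStar e y x = S.embA e 0 := by
  obtain ⟨t, ht⟩ := transfer_exists e (γ := Fin S.m) [S.domAAt 0, S.addAt 1 1 1]
    ⟨Fin S.m ⊕ Fin S.m ⊕ Fin S.m, inferInstance,
      Sum.elim Sum.inr (Sum.elim (Sum.inl ∘ S.av 0) (Sum.inl ∘ S.av 1)), _,
      exists_defines S.definable_add⟩
    (by
      intro v hv
      change ∀ b ∈ _, S.Holds b v at hv
      simp only [List.forall_mem_cons, addAt_iff, domAAt_iff] at hv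
      obtain ⟨⟨z, h3⟩, ⟨x, y, h0, h1, h2⟩, -⟩ := hv
      obtain rfl := S.codeA_injective (h0.trans h1.symm)
      have hx : x = 0 := by simpa using S.codeA_injective (h2.trans h1.symm)
      refine ⟨S.codeA (-z), ?_⟩
      simp only [Sum.comp_elim, Sum.elim_comp_inr, ← Function.comp_assoc, Sum.elim_comp_inl]
      exact mem_graph₂.2 ⟨-z, z, rfl, h3, by rw [neg_add_cancel, ← hx, h0]⟩)
    (S.env (fun _ => S.embG e 1) ![x, S.embA e 0, x, x, x, x]) (by
      change ∀ b ∈ _, S.HoldsStar b _ _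
      simp only [List.forall_mem_cons, addAt_star, domAAt_star, true_and]
      exact ⟨by simpa using S.addStar_emb e 0 0, by simp⟩)
  simp only [Sum.comp_elim, Sum.elim_comp_inr, ← Function.comp_assoc, Sum.elim_comp_inl,
    env_av] at ht
  have htA : t ∈ interp e (Set.range S.codeA) :=
    horn e (β := Fin S.m ⊕ Fin S.m ⊕ Fin S.m)
      [⟨_, inferInstance, id, _, exists_defines S.definable_add⟩]
      ⟨Fin S.m, inferInstance, Sum.inl, _, exists_defines S.definable_A⟩
      (by
        intro v hv
        obtain ⟨⟨x, y⟩, h⟩ := hv _ (List.mem_singleton_self _)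
        exact ⟨x, funext fun i => congrFun h (Sum.inl i)⟩)
      (Sum.elim t (Sum.elim (S.cA x) (S.cA (S.embA e 0)))) (by simpa using ht)
  exact ⟨⟨t, htA⟩, S.addStar_iff.2 ht⟩

/-- The abelian group `A*`. -/
noncomputable instance : AddCommGroup (S.AStar e) :=
  letI : Add (S.AStar e) := ⟨S.addStar e⟩
  letI : Zero (S.AStar e) := ⟨S.embA e 0⟩
  letI : Neg (S.AStar e) := ⟨fun x => (S.exists_neg x).choose⟩
  letI : AddGroup (S.AStar e) :=
    AddGroup.ofLeftAxioms S.addStar_assoc S.zero_addStar fun x => (S.exists_neg x).choose_spec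
  { add_comm := S.addStar_comm }

theorem mul_eq (x y : S.GStar e) : x * y = S.mulStar e x y := rfl

theorem one_eq : (1 : S.GStar e) = S.embG e 1 := rfl

theorem add_eq (x y : S.AStar e) : x + y = S.addStar e x y := rfl

theorem zero_eq : (0 : S.AStar e) = S.embA e 0 := rfl

theorem one_smulStar (y : S.AStar e) : S.smulStar e 1 y = y := by
  have := S.horn_star [S.mulAt 0 0 0, S.domAAt 0] (S.smulAt 0 0 0) (by
      intro v hv
      simp only [List.forall_mem_cons, mulAt_iff, domAAt_iff, smulAt_iff] at hv ⊢
      obtain ⟨⟨x, y, h0, h1, h2⟩, ⟨z, h3⟩, -⟩ := hv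
      obtain rfl := S.codeG_injective (h0.trans h1.symm)
      have hx : x = 1 := by simpa using S.codeG_injective (h2.trans h1.symm)
      exact ⟨x, z, h0, h3, by rw [hx, one_smul, h3]⟩)
    (fun _ => (1 : S.GStar e)) (fun _ => y) (by
      simp only [List.forall_mem_cons, mulAt_star, domAAt_star, true_and]
      exact ⟨one_mul (1 : S.GStar e), by simp⟩)
  exact (S.smulAt_star).1 this

theorem mul_smulStar (x y : S.GStar e) (z : S.AStar e) :
    S.smulStar e (x * y) z = S.smulStar e x (S.smulStar e y z) := by
  have := S.horn_star [S.mulAt 0 1 2, S.smulAt 1 0 1, S.smulAt 0 1 2] (S.smulAt 2 0 2) (by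
      intro v hv
      simp only [List.forall_mem_cons, mulAt_iff, smulAt_iff] at hv ⊢
      obtain ⟨⟨x, y, h0, h1, h2⟩, ⟨y', z, h1', h3, h4⟩, ⟨x', w, h0', h4', h5⟩, -⟩ := hv
      obtain rfl := S.codeG_injective (h0.trans h0'.symm)
      obtain rfl := S.codeG_injective (h1.trans h1'.symm)
      obtain rfl := S.codeA_injective (h4.trans h4'.symm)
      exact ⟨x * y, z, h2, h3, by rw [mul_smul]; exact h5⟩)
    ![x, y, x * y, x, x, x]
    ![z, S.smulStar e y z, S.smulStar e x (S.smulStar e y z), z, z, z] (by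
      simp only [List.forall_mem_cons, mulAt_star, smulAt_star]
      exact ⟨rfl, rfl, rfl, by simp⟩)
  exact (S.smulAt_star).1 this

theorem smulStar_add (x : S.GStar e) (y z : S.AStar e) :
    S.smulStar e x (y + z) = S.smulStar e x y + S.smulStar e x z := by
  have := S.horn_star [S.addAt 0 1 2, S.smulAt 0 0 3, S.smulAt 0 1 4, S.smulAt 0 2 5]
    (S.addAt 3 4 5) (by
      intro v hv
      simp only [List.forall_mem_cons, addAt_iff, smulAt_iff] at hv ⊢
      obtain ⟨⟨a, b, h0, h1, h2⟩, ⟨x, a', hx, h0', h3⟩, ⟨x', b', hx', h1', h4⟩,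
        ⟨x'', c, hx'', h2', h5⟩, -⟩ := hv
      obtain rfl := S.codeG_injective (hx.trans hx'.symm)
      obtain rfl := S.codeG_injective (hx.trans hx''.symm)
      obtain rfl := S.codeA_injective (h0.trans h0'.symm)
      obtain rfl := S.codeA_injective (h1.trans h1'.symm)
      obtain rfl := S.codeA_injective (h2.trans h2'.symm)
      exact ⟨x • a, x • b, h3, h4, by rw [← smul_add]; exact h5⟩)
    (fun _ => x)
    ![y, z, y + z, S.smulStar e x y, S.smulStar e x z, S.smulStar e x (y + z)] (by
      simp only [List.forall_mem_cons, addAt_star, smulAt_star]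
      exact ⟨rfl, rfl, rfl, rfl, by simp⟩)
  exact ((S.addAt_star).1 this).symm

/-- The action of `G*` on `A*`. -/
noncomputable instance : DistribMulAction (S.GStar e) (S.AStar e) where
  smul := S.smulStar e
  one_smul := S.one_smulStar
  mul_smul := S.mul_smulStar
  smul_zero x := by
    have := S.smulStar_add x 0 0
    rw [add_zero] at this
    exact left_eq_add.1 this
  smul_add := S.smulStar_add

theorem smul_eq (x : S.GStar e) (y : S.AStar e) : x • y = S.smulStar e x y := rfl

theorem hFun_one (x : S.GStar e) : S.hFun e x 1 = 0 := by
  have := S.horn_star [S.mulAt 1 1 1, S.addAt 0 0 0, S.domGAt 0] (S.hAt 0 1 0) (by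
      intro v hv
      simp only [List.forall_mem_cons, mulAt_iff, domGAt_iff, addAt_iff, hAt_iff] at hv ⊢
      obtain ⟨⟨x, y, h0, h1, h2⟩, ⟨a, b, k0, k1, k2⟩, ⟨z, h3⟩, -⟩ := hv
      obtain rfl := S.codeG_injective (h0.trans h1.symm)
      obtain rfl := S.codeA_injective (k0.trans k1.symm)
      have hx : x = 1 := by simpa using S.codeG_injective (h2.trans h1.symm)
      have ha : a = 0 := by simpa using S.codeA_injective (k2.trans k1.symm)
      exact ⟨z, x, h3, h0, by rw [hx, S.h.map_one_right, ← ha, k0]⟩)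
    ![x, 1, 1, 1, 1, 1] (fun _ => 0) (by
      simp only [List.forall_mem_cons, mulAt_star, domGAt_star, addAt_star, true_and]
      exact ⟨one_mul (1 : S.GStar e), zero_add (0 : S.AStar e), by simp⟩)
  exact (S.hAt_star).1 this

theorem one_hFun (x : S.GStar e) : S.hFun e 1 x = 0 := by
  have := S.horn_star [S.mulAt 1 1 1, S.addAt 0 0 0, S.domGAt 0] (S.hAt 1 0 0) (by
      intro v hv
      simp only [List.forall_mem_cons, mulAt_iff, domGAt_iff, addAt_iff, hAt_iff] at hv ⊢
      obtain ⟨⟨x, y, h0, h1, h2⟩, ⟨a, b, k0, k1, k2⟩, ⟨z, h3⟩, -⟩ := hv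
      obtain rfl := S.codeG_injective (h0.trans h1.symm)
      obtain rfl := S.codeA_injective (k0.trans k1.symm)
      have hx : x = 1 := by simpa using S.codeG_injective (h2.trans h1.symm)
      have ha : a = 0 := by simpa using S.codeA_injective (k2.trans k1.symm)
      exact ⟨x, z, h0, h3, by rw [hx, S.h.map_one_left, ← ha, k0]⟩)
    ![x, 1, 1, 1, 1, 1] (fun _ => 0) (by
      simp only [List.forall_mem_cons, mulAt_star, domGAt_star, addAt_star, true_and]
      exact ⟨one_mul (1 : S.GStar e), zero_add (0 : S.AStar e), by simp⟩)
  exact (S.hAt_star).1 this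

theorem hFun_cocycle (x y z : S.GStar e) :
    S.hFun e x y + S.hFun e (x * y) z = S.hFun e x (y * z) + x • S.hFun e y z := by
  have := S.horn_star [S.mulAt 0 1 3, S.mulAt 1 2 4, S.hAt 0 1 0, S.hAt 3 2 1, S.addAt 0 1 2,
      S.hAt 0 4 3, S.hAt 1 2 4, S.smulAt 0 4 5] (S.addAt 3 5 2) (by
      intro v hv
      simp only [List.forall_mem_cons, mulAt_iff, addAt_iff, smulAt_iff, hAt_iff] at hv ⊢
      obtain ⟨⟨x, y, hx, hy, hxy⟩, ⟨y1, z, hy1, hz, hyz⟩, ⟨x1, y2, hx1, hy2, h0⟩,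
        ⟨xy1, z1, hxy1, hz1, h1⟩, ⟨a, b, ha, hb, h2⟩, ⟨x2, yz1, hx2, hyz1, h3⟩,
        ⟨y3, z2, hy3, hz2, h4⟩, ⟨x3, d, hx3, hd, h5⟩, -⟩ := hv
      obtain rfl := S.codeG_injective (hx.trans hx1.symm)
      obtain rfl := S.codeG_injective (hx.trans hx2.symm)
      obtain rfl := S.codeG_injective (hx.trans hx3.symm)
      obtain rfl := S.codeG_injective (hy.trans hy1.symm)
      obtain rfl := S.codeG_injective (hy.trans hy2.symm)
      obtain rfl := S.codeG_injective (hy.trans hy3.symm)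
      obtain rfl := S.codeG_injective (hz.trans hz1.symm)
      obtain rfl := S.codeG_injective (hz.trans hz2.symm)
      obtain rfl := S.codeG_injective (hxy.trans hxy1.symm)
      obtain rfl := S.codeG_injective (hyz.trans hyz1.symm)
      obtain rfl := S.codeA_injective (h0.trans ha.symm)
      obtain rfl := S.codeA_injective (h1.trans hb.symm)
      obtain rfl := S.codeA_injective (h4.trans hd.symm)
      exact ⟨_, _, h3, h5, by rw [← S.h.cocycle]; exact h2⟩)
    ![x, y, z, x * y, y * z, 1]
    ![S.hFun e x y, S.hFun e (x * y) z, S.hFun e x y + S.hFun e (x * y) z,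
      S.hFun e x (y * z), S.hFun e y z, x • S.hFun e y z] (by
      simp only [List.forall_mem_cons, mulAt_star, addAt_star, smulAt_star, hAt_star]
      exact ⟨rfl, rfl, rfl, rfl, rfl, rfl, rfl, rfl, by simp⟩)
  exact ((S.addAt_star).1 this).symm

variable (e)

/-- The interpretation `h*` of the 2-cocycle `h` in `N`. -/
noncomputable def hStar : FactorSet (S.GStar e) (S.AStar e) where
  toFun := S.hFun e
  cocycle := S.hFun_cocycle
  map_one_right := S.hFun_one
  map_one_left := S.one_hFun

/-- The extension of `G*` by `A*` defined by `h*`. -/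
abbrev ExtStar : Type w' := Ext (S.hStar e)

/-- The tuple of elements of `N` which an element of the extension is. -/
def cExt (p : S.ExtStar e) : Fin S.m ⊕ Fin S.n → N := Sum.elim (S.cA p.fst) (S.cG p.snd)

/-- The parameter set `B`, as a subset of `N`. -/
def BStar : Set N := e '' S.B

/-- The subgroup `A₀` of `A` generated by the image of `h`, as a subgroup of `A*`. -/
noncomputable def A₀ : AddSubgroup (S.AStar e) :=
  AddSubgroup.closure (Set.range fun p : G × G => S.embA e (S.h.toFun p.1 p.2))

/-- The cocycle `h*` has the same image as `h`. -/
theorem hStar_mem_im (x y : S.GStar e) : ∃ p : G × G,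
    (S.hStar e).toFun x y = S.embA e (S.h.toFun p.1 p.2) := by
  have hfin : (S.codeA '' Set.range fun p : G × G => S.h.toFun p.1 p.2).Finite :=
    S.finite_im.image _
  obtain ⟨h1, h2⟩ := interp_finite e hfin
  have := S.horn_star [S.hAt 0 1 0] ⟨Fin S.m, inferInstance, S.av 0, _, h1⟩ (by
      intro v hv
      simp only [List.forall_mem_cons, hAt_iff] at hv
      obtain ⟨⟨x, y, -, -, h⟩, -⟩ := hv
      exact ⟨_, ⟨(x, y), rfl⟩, h⟩)
    ![x, y, x, x, x, x] (fun _ => S.hFun e x y) (by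
      simp only [List.forall_mem_cons, hAt_star]
      exact ⟨rfl, by simp⟩)
  obtain ⟨_, ⟨_, ⟨p, rfl⟩, rfl⟩, h⟩ := h2 _ this
  exact ⟨p, cA_injective h⟩

theorem hStar_mem (x y : S.GStar e) : (S.hStar e).toFun x y ∈ S.A₀ e := by
  obtain ⟨p, hp⟩ := S.hStar_mem_im e x y
  rw [hp]
  exact AddSubgroup.subset_closure ⟨p, rfl⟩

theorem smul_mem_A₀ (g : S.GStar e) {a : S.AStar e} (ha : a ∈ S.A₀ e) : g • a ∈ S.A₀ e := by
  have h : S.A₀ e ≤ (S.A₀ e).comap (DistribSMul.toAddMonoidHom (S.AStar e) g) := by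
    refine (AddSubgroup.closure_le _).2 ?_
    rintro _ ⟨⟨x, y⟩, rfl⟩
    change g • S.embA e (S.h.toFun x y) ∈ S.A₀ e
    have h1 := (S.hStar e).cocycle g (S.embG e x) (S.embG e y)
    have h2 : (S.hStar e).toFun (S.embG e x) (S.embG e y) = S.embA e (S.h.toFun x y) :=
      S.hFun_emb e x y
    rw [h2] at h1
    rw [eq_sub_iff_add_eq'.2 h1.symm]
    exact sub_mem (add_mem (S.hStar_mem e _ _) (S.hStar_mem e _ _)) (S.hStar_mem e _ _)
  exact h ha

/-- The action of an element of `G*` on `A₀`. -/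
noncomputable def actA₀ (g : S.GStar e) : S.A₀ e →+ S.A₀ e :=
  ((DistribSMul.toAddMonoidHom (S.AStar e) g).comp (S.A₀ e).subtype).codRestrict (S.A₀ e)
    fun a => S.smul_mem_A₀ e g a.2

/-! ### The components -/

/-- `G*^{000}_B`. -/
noncomputable def G000 (κ : Cardinal.{w'}) : Subgroup (S.GStar e) := comp000 L S.cG (S.BStar e) κ

/-- `G*^{00}_B`. -/
noncomputable def G00 (κ : Cardinal.{w'}) : Subgroup (S.GStar e) := comp00 L S.cG (S.BStar e) κ

/-- The component `000` over `B` of the extension of `G*` by `A*`. -/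
noncomputable def Ext000 (κ : Cardinal.{w'}) : Subgroup (S.ExtStar e) :=
  comp000 L (S.cExt e) (S.BStar e) κ

/-- The component `00` over `B` of the extension of `G*` by `A*`. -/
noncomputable def Ext00 (κ : Cardinal.{w'}) : Subgroup (S.ExtStar e) :=
  comp00 L (S.cExt e) (S.BStar e) κ

/-- A subgroup `A*₁` of `A*` of bounded index which is type-definable over `B` and invariant under
the action of `G*`. -/
structure BoundedSubgroup (κ : Cardinal.{w'}) where
  carrier : AddSubgroup (S.AStar e)
  bounded : #(S.AStar e ⧸ carrier) < κ
  typeDefinable : IsTypeDefinable L S.cA (S.BStar e) (carrier : Set (S.AStar e))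
  smul_mem : ∀ (g : S.GStar e), ∀ a ∈ carrier, g • a ∈ carrier

variable {e} {κ : Cardinal.{w'}} (A₁ : S.BoundedSubgroup e κ)

/-- The group `A₀ / (A*₁ ∩ A₀)`. -/
abbrev Quot₀ : Type w' := S.A₀ e ⧸ A₁.carrier.addSubgroupOf (S.A₀ e)

/-- The action of an element of `G*` on `A₀ / (A*₁ ∩ A₀)` induced by the action on `A₀`. -/
noncomputable def actQuot (g : S.GStar e) : S.Quot₀ A₁ →+ S.Quot₀ A₁ :=
  QuotientAddGroup.map _ _ (S.actA₀ e g) fun _ ha => A₁.smul_mem g _ ha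

/-- The 2-cocycle `G* × G* → A₀ / (A*₁ ∩ A₀)` induced by `h*`. -/
noncomputable def hBar (x y : S.GStar e) : S.Quot₀ A₁ :=
  QuotientAddGroup.mk ⟨(S.hStar e).toFun x y, S.hStar_mem e x y⟩

/-- The restriction to the subgroup `H` of `G*` of the induced 2-cocycle is split via `f`. -/
def SplitVia (H : Subgroup (S.GStar e)) (f : H → S.Quot₀ A₁) : Prop :=
  (∀ x y : H, S.hBar A₁ x y = f x + S.actQuot A₁ x (f y) - f (x * y)) ∧ f 1 = 0

/-- The function `f : H → A₀ / (A*₁ ∩ A₀)` is `B`-invariant: if `f x` is the class of `a`, then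
`f (σ x)` is the class of `σ a`, for every automorphism `σ` of `N` which fixes `B` pointwise. -/
def IsInvariantFun (H : Subgroup (S.GStar e)) (f : H → S.Quot₀ A₁) : Prop :=
  ∀ σ : N ≃[L] N, (∀ b ∈ S.BStar e, σ b = b) → ∀ (x y : H) (a b : S.A₀ e),
    (S.cG (y : S.GStar e) = fun i => σ (S.cG (x : S.GStar e) i)) →
    (S.cA (b : S.AStar e) = fun i => σ (S.cA (a : S.AStar e) i)) →
    f x = QuotientAddGroup.mk a → f y = QuotientAddGroup.mk b

/-- The restriction to `H` of the induced 2-cocycle is non-split via `B`-invariant functions. -/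
def NonSplitInvariant (H : Subgroup (S.GStar e)) : Prop :=
  ¬ ∃ f : H → S.Quot₀ A₁, S.IsInvariantFun A₁ H f ∧ S.SplitVia A₁ H f

end Situation

end ConnComp

/-! Write `E` for the extension. Two facts drive everything. Automorphisms over `B` fix `A₀`
pointwise, because the image of `h` lies in `dcl(B)`. And `Ext000` lies in `(A₀ + A*₁) × G*`, an
invariant subgroup of bounded index (`Ext000_le_extSum`), while it projects onto a subgroup
containing `G000` (`G000_le_map_proj`).

Part (2). If `Ext000 ∩ A* ⊆ A*₁`, the fibre of `Ext000` over `g ∈ G000` determines one class of `A₀`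
modulo `A*₁`; its negative is an invariant splitting (`exists_splitting`). Conversely, a splitting
`f` makes `(a, g) ↦ a + f(g)` a crossed homomorphism modulo `A*₁` over `G000`. Its kernel is an
invariant subgroup of bounded index meeting `A*` inside `A*₁`, and it contains `Ext000`
(`interA_subset_of_splitting`).

Part (1). If `Ext00 ∩ A* ⊆ A*₁ ⊆ Ext000`, then each element of `Ext00` differs by an element of
`Ext00 ∩ A*` from one of `Ext000` with the same projection, so the components agree
(`Ext000_eq_Ext00`). For the converse suppose they agree. Then `Ext00` is a type-definable group
inside `(A₀ + A*₁) × G*`. An element of `Ext00 ∩ A*` outside `A*₁` yields `c ∈ A₀` in `Ext00` with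
no nonzero multiple in `A*₁`. A counting argument on the multiples of `c` together with compactness
produces an element of `Ext00 ∩ A*` outside every one of the countably many cosets `a + A*₁`, `a ∈
A₀`, which is absurd (`interA_subset_of_isTypeDefinable`).

The index bounds rest on the fact that the intersection defining the `000` component still has
bounded index: elements with the same type over a small model containing `B` are related by every
bounded invariant equivalence relation (`IsMonster.rel_of_type_eq`), and there are boundedly many
such types. -/

namespace ConnComp

universe u v w

/-! ### Definable sets, saturation, homogeneity and small models -/

section Definability

variable {L : FirstOrder.Language.{u, v}} {N : Type w} [L.Structure N] {α β : Type}

/-- An automorphism which fixes the parameters preserves a definable set. -/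
theorem definable_invariant {C : Set N} {D : Set (α → N)} (hD : C.Definable L D) (σ : N ≃[L] N)
    (hσ : ∀ c ∈ C, σ c = c) {v : α → N} : (fun i => σ (v i)) ∈ D ↔ v ∈ D := by
  obtain ⟨φ, rfl⟩ := Set.definable_iff_exists_formula_sum.1 hD
  simp only [Set.mem_ofPred_eq]
  rw [← Language.StrongHomClass.realize_formula σ φ (v := Sum.elim _ v)]
  have : σ ∘ Sum.elim (fun c : C => (c : N)) v
      = Sum.elim (fun c : C => (c : N)) fun i => σ (v i) := by
    funext i
    rcases i with i | i
    · exact hσ _ i.2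
    · rfl
  rw [this]

/-- Substitution of parameters in a definable set. -/
theorem definable_subst {C : Set N} {D : Set (β ⊕ α → N)} (hD : C.Definable L D) {w : β → N}
    (hw : ∀ i, w i ∈ C) : C.Definable L {v : α → N | Sum.elim w v ∈ D} := by
  obtain ⟨φ, rfl⟩ := Set.definable_iff_exists_formula_sum.1 hD
  refine Set.definable_iff_exists_formula_sum.2
    ⟨φ.relabel (Sum.elim Sum.inl (Sum.elim (fun i => Sum.inl ⟨w i, hw i⟩) Sum.inr)), ?_⟩
  ext v
  simp only [Set.mem_ofPred_eq, Language.Formula.realize_relabel]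
  have : Sum.elim (fun c : C => (c : N)) v ∘
      (Sum.elim Sum.inl (Sum.elim (fun i => Sum.inl ⟨w i, hw i⟩) Sum.inr) : C ⊕ β ⊕ α → C ⊕ α)
      = Sum.elim (fun c : C => (c : N)) (Sum.elim w v) := by
    funext i; rcases i with i | i | i <;> rfl
  rw [this]

theorem definable_subst_right {C : Set N} {D : Set (α ⊕ β → N)} (hD : C.Definable L D) {w : β → N}
    (hw : ∀ i, w i ∈ C) : C.Definable L {v : α → N | Sum.elim v w ∈ D} := by
  have := definable_subst (hD.preimage_comp Sum.swap) hw
  have key : ∀ v : α → N, Sum.elim w v ∘ Sum.swap = Sum.elim v w := fun v => by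
    funext i; rcases i with i | i <;> rfl
  simpa only [Set.mem_preimage, key] using this

/-- The interpretation of a `B`-definable set is definable over the image of `B`. -/
theorem definable_interp {M : Type*} [L.Structure M] (e : M ↪ₑ[L] N) [Finite α] {B : Set M}
    {X : Set (α → M)} (hX : B.Definable L X) : (e '' B).Definable L (interp e X) := by
  obtain ⟨φ, rfl⟩ := Set.definable_iff_exists_formula_sum.1 hX
  refine Set.definable_iff_exists_formula_sum.2
    ⟨φ.relabel (Sum.map (fun b : B => (⟨e b, b, b.2, rfl⟩ : e '' B)) id), ?_⟩
  have h : Defines (φ.relabel (Sum.map (fun b : B => (b : M)) id))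
      {v | φ.Realize (Sum.elim (fun b : B => (b : M)) v)} := fun v => by
    rw [Language.Formula.realize_relabel, Sum.elim_comp_map]
    rfl
  ext v
  rw [mem_interp e h]
  simp only [Set.mem_ofPred_eq, Language.Formula.realize_relabel, Sum.elim_comp_map]
  rfl

/-- In a saturated structure, a family of definable sets over a small set of parameters with the
finite intersection property has nonempty intersection. -/
theorem IsSaturated.compactness [Finite α] {κ : Cardinal.{w}} (hN : IsSaturated L N κ) {C : Set N}
    (hC : #C < κ) (F : Set (Set (α → N))) (hF : ∀ D ∈ F, C.Definable L D)
    (hfin : ∀ T ⊆ F, T.Finite → (⋂₀ T).Nonempty) : (⋂₀ F).Nonempty := by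
  obtain ⟨k, ⟨ε⟩⟩ := Finite.exists_equiv_fin α
  choose! φ hφ using hF
  obtain ⟨v, hv⟩ := hN C hC k ((fun D => (φ D).relabel ε) '' F) (by
    intro q hq
    classical
    obtain ⟨T, hTF, rfl⟩ := Finset.subset_set_image_iff.1 hq
    obtain ⟨v, hv⟩ := hfin T hTF T.finite_toSet
    refine ⟨v ∘ ε.symm, fun ψ hψ => ?_⟩
    obtain ⟨D, hD, rfl⟩ := Finset.mem_image.1 hψ
    have h1 : v ∈ D := hv D hD
    rw [hφ D (hTF hD)] at h1
    simpa [Language.Formula.realize_relabel, Function.comp_assoc] using h1)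
  refine ⟨v ∘ ε, fun D hD => ?_⟩
  have := hv _ ⟨D, hD, rfl⟩
  rw [Language.Formula.realize_relabel] at this
  rw [hφ D hD]
  exact this

/-- Strong homogeneity, for tuples. -/
theorem IsStronglyHomogeneous.exists_automorphism {γ : Type*} {κ : Cardinal.{w}}
    (hN : IsStronglyHomogeneous L N κ) {t t' : γ → N} (ht : #(Set.range t) < κ)
    (h : ∀ φ : L.Formula γ, φ.Realize t ↔ φ.Realize t') : ∃ σ : N ≃[L] N, ∀ i, σ (t i) = t' i := by
  choose s hs using fun c : Set.range t => c.2
  obtain ⟨σ, hσ⟩ := hN (Set.range t) ht (t' ∘ s) (fun φ => by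
    have := h (φ.relabel s)
    rw [Language.Formula.realize_relabel, Language.Formula.realize_relabel] at this
    rwa [show t ∘ s = fun c : Set.range t => (c : N) from funext hs] at this)
  refine ⟨σ, fun i => ?_⟩
  rw [hσ ⟨t i, i, rfl⟩]
  -- The tuple may have repetitions; equality of two coordinates is a formula, so `t'` repeats
  -- wherever `t` does and the choice `s` of indices is harmless.
  have := h (Language.Term.equal (Language.Term.var (s ⟨t i, i, rfl⟩)) (Language.Term.var i))
  simp only [Language.Formula.realize_equal, Language.Term.realize_var] at this
  exact this.1 (hs _)

/-- Tuples which lie in the same `C`-definable sets are conjugate over `C`. -/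
theorem IsMonster.exists_automorphism_of_type_eq [Finite α] {κ : Cardinal.{w}} (hN : IsMonster L N κ)
    {C : Set N} (hC : #C < κ) {x y : α → N} (h : ∀ D, C.Definable L D → (x ∈ D ↔ y ∈ D)) :
    ∃ σ : N ≃[L] N, (∀ c ∈ C, σ c = c) ∧ y = fun i => σ (x i) := by
  obtain ⟨σ, hσ⟩ := hN.homogeneous.exists_automorphism
    (t := Sum.elim (fun c : C => (c : N)) x) (t' := Sum.elim (fun c : C => (c : N)) y)
    (by
      rw [Set.Sum.elim_range, Subtype.range_coe]
      exact (mk_union_le _ _).trans_lt (add_lt_of_lt hN.uncountable.le hC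
        ((lt_aleph0_of_finite _).trans hN.uncountable)))
    (fun φ => h _ (Set.definable_iff_exists_formula_sum.2 ⟨φ, rfl⟩))
  exact ⟨σ, fun c hc => hσ (Sum.inl ⟨c, hc⟩), funext fun i => (hσ (Sum.inr i)).symm⟩

/-- Provides an infinite bound for the language in the universe of `N`, where it can be compared
with the size of models and parameter sets. -/
theorem IsMonster.language_card_lt {κ : Cardinal.{w}} (hN : IsMonster L N κ) :
    ∃ μ : Cardinal.{w}, ℵ₀ ≤ μ ∧ μ < κ ∧ Cardinal.lift.{w} L.card ≤ Cardinal.lift.{max u v} μ := by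
  obtain ⟨μ, hμ⟩ := Cardinal.mem_range_lift_of_le hN.card_lt.le
  refine ⟨max ℵ₀ μ, le_max_left _ _, max_lt hN.uncountable ?_, ?_⟩
  · have := hN.card_lt
    rwa [← hμ, Cardinal.lift_lt] at this
  · rw [← hμ]
    exact Cardinal.lift_le.2 (le_max_right _ _)

/-- A finite set of parameters is contained in a small elementary substructure. -/
theorem IsMonster.exists_small_elementarySubstructure {κ : Cardinal.{w}} (hN : IsMonster L N κ)
    {B : Set N} (hB : B.Finite) :
    ∃ M₀ : L.ElementarySubstructure N, B ⊆ M₀ ∧ #M₀ < κ := by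
  obtain ⟨μ, h0, h1, h2⟩ := hN.language_card_lt
  -- Downward Löwenheim–Skolem at `μ` needs `μ ≤ #N`; if `N` is itself small, the whole of `N`
  -- serves.
  by_cases h : #N < κ
  · exact ⟨⊤, fun _ _ => trivial, (mk_subtype_le _).trans_lt h⟩
  · obtain ⟨M₀, h3, h4⟩ := Language.exists_elementarySubstructure_card_eq L B μ h0
      (Cardinal.lift_le.2 ((lt_aleph0_iff_set_finite.2 hB).le.trans h0)) h2
      (Cardinal.lift_le.2 (h1.le.trans (not_lt.1 h)))
    exact ⟨M₀, h3, (Cardinal.lift_inj.1 h4).trans_lt h1⟩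

/-- A nonempty set which is definable over an elementary substructure has a point there. -/
theorem exists_mem_of_definable [Finite α] (M₀ : L.ElementarySubstructure N) {D : Set (α → N)}
    (hD : (M₀ : Set N).Definable L D) (hne : D.Nonempty) :
    ∃ m : α → M₀, (fun i => (m i : N)) ∈ D := by
  obtain ⟨φ, rfl⟩ := Set.definable_iff_exists_formula_sum.1 hD
  obtain ⟨v, hv⟩ := hne
  have h1 : (φ.iExs α).Realize (M₀.subtype ∘ (id : M₀ → M₀)) :=
    Language.Formula.realize_iExs.2 ⟨v, hv⟩
  rw [M₀.subtype.map_formula] at h1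
  obtain ⟨m, hm⟩ := Language.Formula.realize_iExs.1 h1
  refine ⟨m, ?_⟩
  rw [← M₀.subtype.map_formula] at hm
  simp only [Sum.comp_elim] at hm
  exact hm

/-- There are boundedly many types over a small set. -/
theorem IsMonster.mk_definable_lt [Finite α] {κ : Cardinal.{w}} (hN : IsMonster L N κ) {C : Set N}
    (hC : #C < κ) : #(Set {D : Set (α → N) // C.Definable L D}) < κ := by
  obtain ⟨μ, h0, h1, h2⟩ := hN.language_card_lt
  rw [mk_set]
  -- As `κ` is a strong limit, it is enough that the definable sets themselves, hence the formulas,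
  -- number at most `max μ #C`.
  refine hN.strongLimit.isStrongPrelimit (lt_of_le_of_lt ?_ (max_lt h1 hC))
  rw [← Cardinal.lift_le.{max u v}]
  have h3 : Cardinal.lift.{max u v} #{D : Set (α → N) // C.Definable L D} ≤
      #(L.Formula (C ⊕ α)) := by
    rw [← Cardinal.lift_umax.{w, max u v}, ← Cardinal.lift_id'.{w, max u v w} #(L.Formula (C ⊕ α))]
    refine Cardinal.lift_mk_le_lift_mk_of_surjective
      (f := fun φ : L.Formula (C ⊕ α) => (⟨{v | φ.Realize (Sum.elim (↑) v)},
        Set.definable_iff_exists_formula_sum.2 ⟨φ, rfl⟩⟩ : {D // C.Definable L D})) ?_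
    rintro ⟨D, hD⟩
    obtain ⟨φ, rfl⟩ := Set.definable_iff_exists_formula_sum.1 hD
    exact ⟨φ, rfl⟩
  have h4 : #(L.Formula (C ⊕ α)) ≤ #(Σ n, L.BoundedFormula (C ⊕ α) n) :=
    Cardinal.mk_le_of_injective
      (sigma_mk_injective (β := fun n => L.BoundedFormula (C ⊕ α) n) (i := 0))
  refine h3.trans (h4.trans (Language.BoundedFormula.card_le.trans ?_))
  have h5 : ℵ₀ ≤ max μ #C := h0.trans (le_max_left _ _)
  have h6 : #(C ⊕ α) ≤ max μ #C := by
    rw [mk_sum, Cardinal.lift_uzero]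
    exact add_le_of_le h5 (le_max_right _ _) ((Cardinal.lift_lt_aleph0.2
      (lt_aleph0_of_finite α)).le.trans h5)
  have h7 : ℵ₀ ≤ Cardinal.lift.{max u v} (max μ #C) := Cardinal.aleph0_le_lift.2 h5
  refine max_le h7 (add_le_of_le h7 (Cardinal.lift_le.2 h6)
    (h2.trans (Cardinal.lift_le.2 (le_max_left _ _))))

end Definability

end ConnComp

namespace ConnComp

universe u v w

/-! ### Global types finitely satisfiable in a small model, and their Morley sequences -/

section Coheir

variable {L : FirstOrder.Language.{u, v}} {N : Type w} [L.Structure N] {α : Type}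
  {κ : Cardinal.{w}} {M₀ : L.ElementarySubstructure N}

/-- The tuple `c` realises over `C` the global type which is the limit of tuples of `M₀` along the
ultrafilter `U`. -/
def Realizes (U : Ultrafilter (α → M₀)) (C : Set N) (c : α → N) : Prop :=
  ∀ D : Set (α → N), C.Definable L D → (∀ᶠ m : α → M₀ in U, (fun i => (m i : N)) ∈ D) → c ∈ D

theorem Realizes.mem_iff {U : Ultrafilter (α → M₀)} {C : Set N} {c : α → N} (h : Realizes U C c)
    {D : Set (α → N)} (hD : C.Definable L D) :
    c ∈ D ↔ ∀ᶠ m : α → M₀ in U, (fun i => (m i : N)) ∈ D := by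
  refine ⟨fun hc => ?_, h D hD⟩
  by_contra hn
  exact h Dᶜ hD.compl (Ultrafilter.eventually_not.2 hn) hc

/-- Finitely many conditions that hold `U`-almost everywhere are met by a single tuple of `M₀`, so
saturation applies. -/
theorem IsMonster.exists_realizes [Finite α] (hN : IsMonster L N κ) (U : Ultrafilter (α → M₀))
    {C : Set N} (hC : #C < κ) : ∃ c, Realizes U C c := by
  obtain ⟨c, hc⟩ := hN.saturated.compactness hC
    {D : Set (α → N) | C.Definable L D ∧ ∀ᶠ m : α → M₀ in U, (fun i => (m i : N)) ∈ D}
    (fun D hD => hD.1) (fun T hT hfin => by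
      have : ∀ᶠ m : α → M₀ in U, ∀ D ∈ T, (fun i => (m i : N)) ∈ D :=
        (Filter.eventually_all_finite hfin).2 fun D hD => (hT hD).2
      obtain ⟨m, hm⟩ := this.exists
      exact ⟨_, hm⟩)
  exact ⟨c, fun D h1 h2 => hc D ⟨h1, h2⟩⟩

/-- Every type over `M₀` extends to a global type which is a limit of tuples of `M₀`. -/
theorem exists_ultrafilter_realizes [Finite α] (M₀ : L.ElementarySubstructure N) (a : α → N) :
    ∃ U : Ultrafilter (α → M₀), Realizes U M₀ a := by
  obtain ⟨U, hU⟩ := Ultrafilter.exists_ultrafilter_of_finite_inter_nonempty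
    ((fun D : Set (α → N) => {m : α → M₀ | (fun i => (m i : N)) ∈ D}) ''
      {D | (M₀ : Set N).Definable L D ∧ a ∈ D}) (by
    intro T hT
    classical
    obtain ⟨T, hT', rfl⟩ := Finset.subset_set_image_iff.1 hT
    -- The traces on `M₀` of the sets in the type of `a` have the finite intersection property,
    -- because `M₀` is an elementary substructure.
    obtain ⟨m, hm⟩ := exists_mem_of_definable M₀
      (Set.definable_biInter_finset (f := fun D : {D : Set (α → N) //
        (M₀ : Set N).Definable L D ∧ a ∈ D} => (D : Set (α → N))) (fun D => D.2.1)
        (T.subtype fun D => (M₀ : Set N).Definable L D ∧ a ∈ D))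
      ⟨a, Set.mem_iInter₂.2 fun D _ => D.2.2⟩
    refine ⟨m, ?_⟩
    rintro _ hs
    obtain ⟨D, hD, rfl⟩ := Finset.mem_image.1 hs
    exact Set.mem_iInter₂.1 hm ⟨D, hT' hD⟩ (Finset.mem_subtype.2 hD))
  refine ⟨U, fun D hD h => ?_⟩
  by_contra ha
  exact Ultrafilter.eventually_not.1 (hU ⟨Dᶜ, ⟨hD.compl, ha⟩, rfl⟩) h

/-- A Morley sequence in the limit type of an ultrafilter. -/
theorem IsMonster.exists_morley_sequence [Finite α] (hN : IsMonster L N κ)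
    (U : Ultrafilter (α → M₀)) (hM₀ : #M₀ < κ) {I : Type w} [LinearOrder I] [WellFoundedLT I]
    (hI : #I < κ) : ∃ c : I → α → N,
      ∀ i, Realizes U (M₀ ∪ ⋃ j : Set.Iio i, Set.range (c j)) (c i) := by
  classical
  have : Nonempty (α → N) := ⟨(hN.exists_realizes U hM₀).choose⟩
  -- The value of `r` is arbitrary on sets that are not small; the sets met in the recursion are
  -- shown to be small at the end.
  choose! r hr using fun C : Set N => fun hC : #C < κ => hN.exists_realizes U hC
  let c : I → α → N := WellFoundedLT.fix fun i ih =>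
    r (M₀ ∪ ⋃ j : Set.Iio i, Set.range (ih j.1 j.2))
  refine ⟨c, fun i => ?_⟩
  have h : c i = r (M₀ ∪ ⋃ j : Set.Iio i, Set.range (c j)) := WellFoundedLT.fix_eq _ i
  rw [h]
  refine hr _ ((mk_union_le _ _).trans_lt (add_lt_of_lt hN.uncountable.le hM₀ ?_))
  have h1 : #(⋃ j : Set.Iio i, Set.range (c j)) ≤ #(Set.Iio i) * ℵ₀ := by
    refine (mk_iUnion_le _).trans (mul_le_mul' le_rfl (ciSup_le' fun j => ?_))
    exact (lt_aleph0_of_finite _).le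
  exact h1.trans_lt (mul_lt_of_lt hN.uncountable.le ((mk_set_le _).trans_lt hI) hN.uncountable)

/-- If `d` and `d'` have the same type over `M₀`, then so do `(d, c)` and `(d', c')`, for
realisations `c` and `c'` of the limit type of an ultrafilter over `d` and over `d'`. -/
theorem Realizes.pair_mem_iff {U : Ultrafilter (α → M₀)} {C C' : Set N} {c c' d d' : α → N}
    (hc : Realizes U C c) (hc' : Realizes U C' c') (hC : (M₀ : Set N) ⊆ C)
    (hC' : (M₀ : Set N) ⊆ C') (hd : ∀ i, d i ∈ C) (hd' : ∀ i, d' i ∈ C')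
    (hdd' : ∀ D : Set (α → N), (M₀ : Set N).Definable L D → (d ∈ D ↔ d' ∈ D))
    {D : Set (α ⊕ α → N)} (hD : (M₀ : Set N).Definable L D) :
    Sum.elim d c ∈ D ↔ Sum.elim d' c' ∈ D := by
  have h1 := hc.mem_iff (definable_subst (hD.mono hC) hd)
  have h2 := hc'.mem_iff (definable_subst (hD.mono hC') hd')
  simp only [Set.mem_ofPred_eq] at h1 h2
  rw [h1, h2]
  -- For fixed `m` in `M₀`, the condition `(d, m) ∈ D` is `M₀`-definable in `d`, so `d` and `d'`
  -- satisfy it for exactly the same `m`.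
  refine Filter.eventually_congr (Filter.Eventually.of_forall fun m => ?_)
  exact hdd' _ (definable_subst_right hD fun i => (m i).2)

end Coheir

/-! ### Types over a model and bounded invariant equivalence relations -/

section Lascar

variable {L : FirstOrder.Language.{u, v}} {N : Type w} [L.Structure N] {α : Type} [Finite α]
  {κ : Cardinal.{w}} {X : Type w} {c : X → α → N} {B : Set N}

/-- Elements with the same type over an elementary substructure containing `B` are equivalent
under any `B`-invariant equivalence relation with boundedly many classes. -/
theorem IsMonster.rel_of_type_eq (hN : IsMonster L N κ) (hc : B.Definable L (Set.range c))
    {M₀ : L.ElementarySubstructure N} (hBM : B ⊆ M₀) (hM₀ : #M₀ < κ) (r : Setoid X)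
    (hinv : ∀ σ : N ≃[L] N, (∀ b ∈ B, σ b = b) → ∀ x y x' y' : X,
      (c x' = fun i => σ (c x i)) → (c y' = fun i => σ (c y i)) → r x y → r x' y')
    (hr : #(Quotient r) < κ) {x y : X}
    (hxy : ∀ D : Set (α → N), (M₀ : Set N).Definable L D → (c x ∈ D ↔ c y ∈ D)) : r x y := by
  obtain ⟨U, hU⟩ := exists_ultrafilter_realizes M₀ (c x)
  have hXd : (M₀ : Set N).Definable L (Set.range c) := hc.mono hBM
  let C : Set N := M₀ ∪ (Set.range (c x) ∪ Set.range (c y))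
  have hMC : (M₀ : Set N) ⊆ C := Set.subset_union_left
  have hC : #C < κ := by
    refine (mk_union_le _ _).trans_lt (add_lt_of_lt hN.uncountable.le hM₀ ?_)
    exact (lt_aleph0_of_finite _).trans hN.uncountable
  obtain ⟨t, ht⟩ := hN.exists_realizes U hC
  have same : ∀ {C' : Set N} {t' : α → N}, (M₀ : Set N) ⊆ C' → Realizes U C' t' →
      ∀ D : Set (α → N), (M₀ : Set N).Definable L D → (c x ∈ D ↔ t' ∈ D) := by
    intro C' t' hC' ht' D hD
    rw [hU.mem_iff hD, ht'.mem_iff (hD.mono hC')]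
  obtain ⟨z, rfl⟩ := (same hMC ht _ hXd).1 ⟨x, rfl⟩
  -- Both `x` and `y` turn out to be equivalent to the same `z`, a realisation of the coheir over
  -- both of them. If `w` and `z` were inequivalent, so would be any two terms of a Morley sequence,
  -- since each such pair is conjugate to `(w, z)` over `M₀`.
  have key : ∀ w : X, (∀ i, c w i ∈ C) →
      (∀ D : Set (α → N), (M₀ : Set N).Definable L D → (c x ∈ D ↔ c w ∈ D)) → r w z := by
    intro w hw hxw
    by_contra hn
    -- One term too many for the number of classes, yet still small because `κ` is a limit cardinal.
    let I := (Order.succ #(Quotient r)).ord.ToType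
    have hI : #I = Order.succ #(Quotient r) := mk_ord_toType _
    have hIκ : #I < κ := hI ▸ hN.strongLimit.isSuccLimit.succ_lt hr
    obtain ⟨s, hs⟩ := hN.exists_morley_sequence U hM₀ hIκ
    choose ζ hζ using fun i => (same Set.subset_union_left (hs i) _ hXd).1 ⟨x, rfl⟩
    have hlt : ∀ i j, j < i → ¬ r (ζ j) (ζ i) := by
      intro i j hji hij
      obtain ⟨σ, h1, h2⟩ := hN.exists_automorphism_of_type_eq hM₀
        (x := Sum.elim (s j) (s i)) (y := Sum.elim (c w) (c z)) fun D hD =>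
          (hs i).pair_mem_iff ht Set.subset_union_left hMC
            (fun k => Or.inr (Set.mem_iUnion.2 ⟨⟨j, hji⟩, k, rfl⟩)) hw
            (fun D hD => (same Set.subset_union_left (hs j) D hD).symm.trans (hxw D hD)) hD
      refine hn (hinv σ (fun b hb => h1 b (hBM hb)) (ζ j) (ζ i) w z ?_ ?_ hij)
      · rw [hζ]
        exact funext fun k => congrFun h2 (Sum.inl k)
      · rw [hζ]
        exact funext fun k => congrFun h2 (Sum.inr k)
    have hinj : Function.Injective fun i : I => (Quotient.mk r (ζ i)) := by
      intro i j hij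
      rcases lt_trichotomy i j with h | h | h
      · exact absurd (Quotient.exact hij) (hlt _ _ h)
      · exact h
      · exact absurd (Quotient.exact hij.symm) (hlt _ _ h)
    have := mk_le_of_injective hinj
    rw [hI] at this
    exact (Order.lt_succ _).not_ge this
  have h1 := key x (fun i => Or.inr (Or.inl ⟨i, rfl⟩)) fun _ _ => Iff.rfl
  have h2 := key y (fun i => Or.inr (Or.inr ⟨i, rfl⟩)) hxy
  exact r.trans' h1 (r.symm' h2)

end Lascar

/-! ### Bounded index of the component `000` -/

section Index

variable {X Y : Type w} [Group X]

/-- Restricted to coset representatives, `ψ` is injective. The index bounds below all come from a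
suitable `ψ`. -/
theorem mk_quotient_le {K : Subgroup X} (ψ : X → Y) (h : ∀ p q, ψ p = ψ q → p⁻¹ * q ∈ K) :
    #(X ⧸ K) ≤ #Y := by
  refine mk_le_of_injective (f := fun t : X ⧸ K => ψ t.out) fun s t hst => ?_
  have := QuotientGroup.eq.2 (h _ _ hst)
  rwa [QuotientGroup.out_eq', QuotientGroup.out_eq'] at this

variable {L : FirstOrder.Language.{u, v}} {N : Type w} [L.Structure N] {α : Type}
  {κ : Cardinal.{w}} {c : X → α → N} {B : Set N}

/-- The component `000` has bounded index. -/
theorem IsMonster.mk_quotient_comp000_lt [Finite α] (hN : IsMonster L N κ) (hB : B.Finite)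
    (hc : B.Definable L (Set.range c))
    (hinj : Function.Injective c)
    (hact : ∀ σ : N ≃[L] N, (∀ b ∈ B, σ b = b) →
      ∃ τ : X →* X, ∀ x, c (τ x) = fun i => σ (c x i)) :
    #(X ⧸ comp000 L c B κ) < κ := by
  obtain ⟨M₀, hBM, hM₀⟩ := hN.exists_small_elementarySubstructure hB
  -- Here `ψ` sends `x` to its type over `M₀`, which determines the coset of `x` modulo every
  -- bounded invariant subgroup at once.
  refine (mk_quotient_le (fun x => {D : {D : Set (α → N) // (M₀ : Set N).Definable L D} |
    c x ∈ D.1}) fun p q hpq => ?_).trans_lt (hN.mk_definable_lt (α := α) hM₀)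
  refine Subgroup.mem_sInf.2 fun H hH => ?_
  refine QuotientGroup.leftRel_apply.1 (hN.rel_of_type_eq hc hBM hM₀ (QuotientGroup.leftRel H)
    (fun σ hσ x y x' y' hx hy h => ?_) hH.2 fun D hD => Set.ext_iff.1 hpq ⟨D, hD⟩)
  obtain ⟨τ, hτ⟩ := hact σ hσ
  rw [QuotientGroup.leftRel_apply] at h ⊢
  rw [hinj (hx.trans (hτ x).symm), hinj (hy.trans (hτ y).symm), ← map_inv, ← map_mul]
  exact hH.1 σ hσ _ _ (hτ _) h

end Index

end ConnComp

namespace ConnComp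

universe u v w w'

namespace Situation

variable {L : FirstOrder.Language.{u, v}} {M : Type w} {N : Type w'} [L.Structure M]
  [L.Structure N] {G A : Type*} [Group G] [AddCommGroup A] [DistribMulAction G A]
  (S : Situation L M G A) {e : M ↪ₑ[L] N}

/-! ### Action of automorphisms on `G*`, `A*` and the extension -/

section Automorphisms

theorem aut_mem_interp {α : Type} [Finite α] {X : Set (α → M)}
    (hX : (∅ : Set M).Definable L X) (σ : N ≃[L] N) {v : α → N} :
    (fun i => σ (v i)) ∈ interp e X ↔ v ∈ interp e X :=
  definable_invariant (definable_interp e hX) σ (by simp)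

/-- The action of an automorphism of `N` on `G*`. -/
noncomputable def autG (σ : N ≃[L] N) : S.GStar e →* S.GStar e :=
  MonoidHom.mk' (fun x => ⟨fun i => σ (S.cG x i), (aut_mem_interp (e := e) S.definable_G σ).2 x.2⟩) (by
    intro x y
    refine (S.mulStar_iff.2 ?_).symm
    have := (aut_mem_interp (e := e) S.definable_mul σ).2 (S.mulStar_iff.1 (S.mul_eq x y).symm)
    convert this using 1
    funext i
    rcases i with i | i | i <;> rfl)

/-- The action of an automorphism of `N` on `A*`. -/
noncomputable def autA (σ : N ≃[L] N) : S.AStar e →+ S.AStar e :=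
  AddMonoidHom.mk' (fun x => ⟨fun i => σ (S.cA x i), (aut_mem_interp (e := e) S.definable_A σ).2 x.2⟩) (by
    intro x y
    refine (S.addStar_iff.2 ?_).symm
    have := (aut_mem_interp (e := e) S.definable_add σ).2 (S.addStar_iff.1 (S.add_eq x y).symm)
    convert this using 1
    funext i
    rcases i with i | i | i <;> rfl)

theorem cG_autG (σ : N ≃[L] N) (x : S.GStar e) :
    S.cG (S.autG σ x) = fun i => σ (S.cG x i) := rfl

theorem cA_autA (σ : N ≃[L] N) (a : S.AStar e) :
    S.cA (S.autA σ a) = fun i => σ (S.cA a i) := rfl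

theorem autA_smul (σ : N ≃[L] N) (x : S.GStar e) (a : S.AStar e) :
    S.autA σ (x • a) = S.autG σ x • S.autA σ a := by
  refine (S.smulStar_iff.2 ?_).symm
  have := (aut_mem_interp (e := e) S.definable_smul σ).2 (S.smulStar_iff.1 (S.smul_eq x a).symm)
  convert this using 1
  funext i
  rcases i with i | i | i <;> rfl

variable {S} {σ : N ≃[L] N}

/-- Unlike the group operations, the cocycle is definable only over `B`; hence only automorphisms
over `B` are used on the extension. -/
theorem autA_hStar (hσ : ∀ b ∈ S.BStar e, σ b = b) (x y : S.GStar e) :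
    S.autA σ ((S.hStar e).toFun x y) = (S.hStar e).toFun (S.autG σ x) (S.autG σ y) := by
  refine (S.hFun_iff.2 ?_).symm
  have := (definable_invariant (definable_interp e S.definable_h) σ hσ).2
    (S.hFun_iff.1 (show S.hFun e x y = _ from rfl))
  convert this using 1
  funext i
  rcases i with i | i | i <;> rfl

/-- The automorphisms of `N` over `B` fix `A₀` pointwise. -/
theorem autA_of_mem_A₀ (hσ : ∀ b ∈ S.BStar e, σ b = b) {a : S.AStar e} (ha : a ∈ S.A₀ e) :
    S.autA σ a = a := by
  have h : S.A₀ e ≤ AddMonoidHom.eqLocus (S.autA σ) (AddMonoidHom.id _) := by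
    refine (AddSubgroup.closure_le _).2 ?_
    rintro _ ⟨⟨x, y⟩, rfl⟩
    have h1 := S.im_dcl x y
    have h2 := (definable_invariant (definable_interp e h1) σ hσ
      (v := S.cA (S.embA e (S.h.toFun x y)))).2 ((mem_interp_comp e h1).2 rfl)
    -- A `B`-definable singleton of `M` is interpreted in `N` by the same single point.
    obtain ⟨_, rfl, h3⟩ := (interp_finite e (Set.finite_singleton _)).2 _ h2
    exact cA_injective h3
  exact h ha

/-- The action on the extension of an automorphism of `N` over `B`. -/
noncomputable def autExt (hσ : ∀ b ∈ S.BStar e, σ b = b) : S.ExtStar e →* S.ExtStar e :=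
  MonoidHom.mk' (fun p => ⟨S.autA σ p.fst, S.autG σ p.snd⟩) (by
    intro p q
    simp only [Ext.mul_def, map_add, map_mul, autA_smul, autA_hStar hσ])

theorem cExt_autExt (hσ : ∀ b ∈ S.BStar e, σ b = b) (p : S.ExtStar e) :
    S.cExt e (autExt hσ p) = fun i => σ (S.cExt e p i) := by
  funext i
  rcases i with i | i <;> rfl

end Automorphisms

/-! ### Definability of the codes; invariance and type-definability of the components -/

section Codes

theorem cExt_injective : Function.Injective (S.cExt e) := by
  rintro ⟨a, g⟩ ⟨b, k⟩ h
  obtain rfl : a = b := cA_injective (funext fun i => congrFun h (Sum.inl i))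
  obtain rfl : g = k := cG_injective (funext fun i => congrFun h (Sum.inr i))
  rfl

theorem range_cG : Set.range (S.cG (e := e)) = interp e (Set.range S.codeG) := Subtype.range_val

theorem range_cA : Set.range (S.cA (e := e)) = interp e (Set.range S.codeA) := Subtype.range_val

theorem definable_range_cG : (S.BStar e).Definable L (Set.range (S.cG (e := e))) := by
  rw [range_cG]
  exact (definable_interp e S.definable_G).mono (by simp)

theorem definable_range_cA : (S.BStar e).Definable L (Set.range (S.cA (e := e))) := by
  rw [range_cA]
  exact (definable_interp e S.definable_A).mono (by simp)

theorem definable_range_cExt : (S.BStar e).Definable L (Set.range (S.cExt e)) := by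
  convert (S.definable_range_cA.preimage_comp Sum.inl).inter
    (S.definable_range_cG.preimage_comp Sum.inr) using 1
  ext v
  constructor
  · rintro ⟨p, rfl⟩
    exact ⟨⟨p.fst, rfl⟩, ⟨p.snd, rfl⟩⟩
  · rintro ⟨⟨a, ha⟩, ⟨g, hg⟩⟩
    refine ⟨⟨a, g⟩, funext fun i => ?_⟩
    rcases i with i | i
    · exact congrFun ha i
    · exact congrFun hg i

theorem finite_BStar : (S.BStar e).Finite := S.finite_B.image _

/-- A type-definable set is invariant. -/
theorem _root_.ConnComp.IsTypeDefinable.isInvariant {α : Type} {X : Type*} {c : X → α → N}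
    (hc : Function.Injective c) {B : Set N} {T : Set X} (h : IsTypeDefinable L c B T) :
    IsInvariant L c B T := by
  obtain ⟨F, hF, hT⟩ := h
  intro σ hσ x y hxy hx
  rw [← hc.mem_set_image, hT] at hx ⊢
  intro D hD
  rw [hxy]
  exact (definable_invariant (hF D hD) σ hσ).2 (hx D hD)

theorem _root_.ConnComp.isInvariant_comp000 {α : Type} {X : Type w'} [Group X] (c : X → α → N)
    (B : Set N) (κ : Cardinal.{w'}) : IsInvariant L c B (comp000 L c B κ : Set X) :=
  fun σ hσ x y hxy hx => Subgroup.mem_sInf.2 fun _ hH =>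
    hH.1 σ hσ x y hxy (Subgroup.mem_sInf.1 hx _ hH)

theorem _root_.ConnComp.comp000_le_comp00 {α : Type} {X : Type w'} [Group X] {c : X → α → N}
    (hc : Function.Injective c) (B : Set N) (κ : Cardinal.{w'}) :
    comp000 L c B κ ≤ comp00 L c B κ :=
  sInf_le_sInf fun _ hH => ⟨hH.1.isInvariant hc, hH.2⟩

/-- Collect all `B`-definable sets containing one of the subgroups in the intersection. The range of
`c` is added so that a tuple in the intersection is known to be a code. -/
theorem _root_.ConnComp.isTypeDefinable_comp00 {α : Type} {X : Type w'} [Group X] {c : X → α → N}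
    (hc : Function.Injective c) {B : Set N} (hX : B.Definable L (Set.range c)) (κ : Cardinal.{w'}) :
    IsTypeDefinable L c B (comp00 L c B κ : Set X) := by
  refine ⟨{D | B.Definable L D ∧ (D = Set.range c ∨ ∃ H : Subgroup X,
    (IsTypeDefinable L c B (H : Set X) ∧ #(X ⧸ H) < κ) ∧ c '' H ⊆ D)}, fun D hD => hD.1, ?_⟩
  ext v
  constructor
  · rintro ⟨x, hx, rfl⟩ D ⟨hD, rfl | ⟨H, hH, hHD⟩⟩
    · exact ⟨x, rfl⟩
    · exact hHD ⟨x, Subgroup.mem_sInf.1 hx H hH, rfl⟩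
  · intro hv
    obtain ⟨x, rfl⟩ := hv _ ⟨hX, Or.inl rfl⟩
    refine ⟨x, Subgroup.mem_sInf.2 fun H hH => ?_, rfl⟩
    obtain ⟨F, hF, hHF⟩ := hH.1
    rw [← SetLike.mem_coe, ← hc.mem_set_image, hHF]
    exact fun D hD => hv D ⟨hF D hD, Or.inr ⟨H, hH, hHF ▸ Set.sInter_subset_of_mem hD⟩⟩

end Codes

/-! ### Bounded index of `G000` and `Ext000` -/

section Bounded

variable {κ : Cardinal.{w'}} {S}

theorem mk_quotient_G000_lt (hN : IsMonster L N κ) : #(S.GStar e ⧸ S.G000 e κ) < κ :=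
  hN.mk_quotient_comp000_lt S.finite_BStar S.definable_range_cG cG_injective
    fun σ _ => ⟨S.autG σ, S.cG_autG σ⟩

theorem mk_quotient_Ext000_lt (hN : IsMonster L N κ) : #(S.ExtStar e ⧸ S.Ext000 e κ) < κ :=
  hN.mk_quotient_comp000_lt S.finite_BStar S.definable_range_cExt S.cExt_injective
    fun _ hσ => ⟨autExt hσ, cExt_autExt hσ⟩

end Bounded

end Situation

end ConnComp

namespace ConnComp

universe u v w w'

namespace Situation

variable {L : FirstOrder.Language.{u, v}} {M : Type w} {N : Type w'} [L.Structure M]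
  [L.Structure N] {G A : Type*} [Group G] [AddCommGroup A] [DistribMulAction G A]
  {S : Situation L M G A} {e : M ↪ₑ[L] N} {κ : Cardinal.{w'}} (A₁ : S.BoundedSubgroup e κ)

/-! ### Components of the extension compared with those of `G*` -/

section Extension

theorem smul_mem_sup (g : S.GStar e) {a : S.AStar e} (ha : a ∈ S.A₀ e ⊔ A₁.carrier) :
    g • a ∈ S.A₀ e ⊔ A₁.carrier := by
  obtain ⟨b, hb, c, hc, rfl⟩ := AddSubgroup.mem_sup.1 ha
  rw [smul_add]
  exact AddSubgroup.add_mem_sup (S.smul_mem_A₀ e g hb) (A₁.smul_mem g c hc)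

/-- The subgroup `(A₀ + A*₁) × G*` of the extension. -/
def extSum : Subgroup (S.ExtStar e) where
  carrier := {p | p.fst ∈ S.A₀ e ⊔ A₁.carrier}
  one_mem' := zero_mem (S.A₀ e ⊔ A₁.carrier)
  mul_mem' hp hq := add_mem (add_mem hp (smul_mem_sup A₁ _ hq))
    (AddSubgroup.mem_sup_left (S.hStar_mem e _ _))
  inv_mem' hp := sub_mem (neg_mem (smul_mem_sup A₁ _ hp))
    (AddSubgroup.mem_sup_left (S.hStar_mem e _ _))

/-- Automorphisms over `B` fix `A₀` and preserve `A*₁`, so `extSum A₁` is invariant. Its index is at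
most that of `A*₁` in `A*`: if `p` and `q` have first components congruent modulo `A*₁`, that of
`p⁻¹ * q` is an element of `A*₁` up to values of the cocycle. -/
theorem Ext000_le_extSum : S.Ext000 e κ ≤ extSum A₁ := by
  refine sInf_le ⟨fun σ hσ p q hpq hp => ?_, (mk_quotient_le
    (fun p => (QuotientAddGroup.mk p.fst : S.AStar e ⧸ A₁.carrier)) fun p q hpq => ?_).trans_lt
      A₁.bounded⟩
  · obtain rfl : q = autExt hσ p := cExt_injective S (hpq.trans (cExt_autExt hσ p).symm)
    obtain ⟨b, hb, c, hc, h⟩ := AddSubgroup.mem_sup.1 (show p.fst ∈ S.A₀ e ⊔ A₁.carrier from hp)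
    change S.autA σ p.fst ∈ S.A₀ e ⊔ A₁.carrier
    rw [← h, map_add, autA_of_mem_A₀ hσ hb]
    exact AddSubgroup.add_mem_sup hb (A₁.typeDefinable.isInvariant cA_injective σ hσ _ _
      (S.cA_autA σ c) hc)
  · rw [QuotientAddGroup.eq] at hpq
    change -(p.snd⁻¹ • p.fst) - (S.hStar e).toFun p.snd⁻¹ p.snd + p.snd⁻¹ • q.fst
      + (S.hStar e).toFun p.snd⁻¹ q.snd ∈ S.A₀ e ⊔ A₁.carrier
    have h1 := smul_mem_sup A₁ p.snd⁻¹ (AddSubgroup.mem_sup_right hpq)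
    have h2 : ∀ x y, (S.hStar e).toFun x y ∈ S.A₀ e ⊔ A₁.carrier := fun x y =>
      AddSubgroup.mem_sup_left (S.hStar_mem e _ _)
    convert add_mem (sub_mem h1 (h2 p.snd⁻¹ p.snd)) (h2 p.snd⁻¹ q.snd) using 1
    rw [smul_add, smul_neg]
    abel

/-- The projection of the extension of `G*` by `A*` onto `G*`. -/
noncomputable def proj : S.ExtStar e →* S.GStar e where
  toFun := Ext.snd
  map_one' := rfl
  map_mul' _ _ := rfl

/-- The image of `Ext000` is invariant, since automorphisms lift to the extension, and of bounded
index, since `Ext000` has bounded index. -/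
theorem G000_le_map_proj (hN : IsMonster L N κ) :
    S.G000 e κ ≤ (S.Ext000 e κ).map proj := by
  refine sInf_le ⟨fun σ hσ x y hxy => ?_, (mk_quotient_le
    (fun x => (QuotientGroup.mk ⟨0, x⟩ : S.ExtStar e ⧸ S.Ext000 e κ)) fun x y hxy => ?_).trans_lt
      (mk_quotient_Ext000_lt hN)⟩
  · rintro ⟨p, hp, rfl⟩
    exact ⟨autExt hσ p, isInvariant_comp000 _ _ _ σ hσ _ _ (cExt_autExt hσ p) hp,
      cG_injective hxy.symm⟩
  · exact ⟨_, QuotientGroup.eq.1 hxy, rfl⟩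

theorem mk_quotient_comap_proj_lt {H : Subgroup (S.GStar e)} (hH : #(S.GStar e ⧸ H) < κ) :
    #(S.ExtStar e ⧸ H.comap proj) < κ := by
  refine (mk_quotient_le (fun p => (QuotientGroup.mk (proj p) : S.GStar e ⧸ H))
    fun p q hpq => ?_).trans_lt hH
  rw [Subgroup.mem_comap, map_mul, map_inv]
  exact QuotientGroup.eq.1 hpq

/-- The preimage of a type-definable subgroup of bounded index is again one. -/
theorem Ext00_le_comap_proj : S.Ext00 e κ ≤ (S.G00 e κ).comap proj := by
  intro p hp
  refine Subgroup.mem_sInf.2 fun H hH => ?_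
  refine Subgroup.mem_sInf.1 hp (H.comap proj) ⟨?_, mk_quotient_comap_proj_lt hH.2⟩
  obtain ⟨F, hF, hT⟩ := hH.1
  refine ⟨insert (Set.range (S.cExt e)) ((fun D => {v | v ∘ Sum.inr ∈ D}) '' F), ?_, ?_⟩
  · rintro _ (rfl | ⟨D, hD, rfl⟩)
    · exact S.definable_range_cExt
    · exact (hF D hD).preimage_comp Sum.inr
  · ext v
    rw [Set.sInter_insert, Set.sInter_image]
    constructor
    · rintro ⟨q, hq, rfl⟩
      refine ⟨⟨q, rfl⟩, Set.mem_iInter₂.2 fun D hD => ?_⟩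
      exact (hT.le ⟨q.snd, hq, rfl⟩ : S.cG q.snd ∈ ⋂₀ F) D hD
    · rintro ⟨⟨q, rfl⟩, hq⟩
      refine ⟨q, ?_, rfl⟩
      obtain ⟨x, hx, hxq⟩ := hT.ge (fun D hD => Set.mem_iInter₂.1 hq D hD :
        S.cG q.snd ∈ ⋂₀ F)
      rwa [cG_injective hxq] at hx

theorem Ext000_le_Ext00 : S.Ext000 e κ ≤ S.Ext00 e κ := comp000_le_comp00 S.cExt_injective _ _

/-- If `G*^{000}_B = G*^{00}_B`, then the components of the extension are equal as soon as their
intersections with `A*` are. -/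
theorem Ext000_eq_Ext00 (hN : IsMonster L N κ) (hG : S.G000 e κ = S.G00 e κ)
    (h : Ext.interA (S.Ext00 e κ) ⊆ Ext.interA (S.Ext000 e κ)) : S.Ext000 e κ = S.Ext00 e κ := by
  refine le_antisymm Ext000_le_Ext00 fun p hp => ?_
  obtain ⟨q, hq, hqp⟩ := G000_le_map_proj hN (hG.ge (Ext00_le_comap_proj hp))
  have h1 : p * q⁻¹ = ⟨(p * q⁻¹).fst, 1⟩ := by
    refine Ext.ext rfl ?_
    change proj (p * q⁻¹) = 1
    rw [map_mul, map_inv, hqp]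
    exact mul_inv_cancel _
  have h2 : (p * q⁻¹).fst ∈ Ext.interA (S.Ext00 e κ) := by
    change (⟨_, 1⟩ : S.ExtStar e) ∈ S.Ext00 e κ
    rw [← h1]
    exact mul_mem hp (inv_mem (Ext000_le_Ext00 hq))
  have h3 : (⟨_, 1⟩ : S.ExtStar e) ∈ S.Ext000 e κ := h h2
  rw [← h1] at h3
  simpa using mul_mem h3 hq

end Extension

/-! ### Invariant splittings and `Ext000 ∩ A*` -/

section Splitting

/-- Elements of `A₀` have the same class in `A₀ / (A*₁ ∩ A₀)` iff their difference is in `A*₁`. -/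
theorem mk_eq_mk_iff {a b : S.A₀ e} : (QuotientAddGroup.mk a : S.Quot₀ A₁) = QuotientAddGroup.mk b ↔
    (b : S.AStar e) - a ∈ A₁.carrier := by
  rw [QuotientAddGroup.eq, AddSubgroup.mem_addSubgroupOf, neg_add_eq_sub]
  rfl

/-- If `Ext000 ∩ A* ⊆ A*₁`, then the induced cocycle splits on `G000` via an invariant function. -/
theorem exists_splitting (hN : IsMonster L N κ)
    (hA : Ext.interA (S.Ext000 e κ) ⊆ (A₁.carrier : Set (S.AStar e))) :
    ∃ f : S.G000 e κ → S.Quot₀ A₁, S.IsInvariantFun A₁ _ f ∧ S.SplitVia A₁ _ f := by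
  -- `R g a` says that the coset `a + A*₁` meets the fibre of `Ext000` over `g`. Two points of a
  -- fibre differ by an element of `Ext000 ∩ A* ⊆ A*₁`, so the class of `a` is unique.
  let R : S.GStar e → S.A₀ e → Prop := fun g a =>
    ∃ b ∈ A₁.carrier, (⟨a + b, g⟩ : S.ExtStar e) ∈ S.Ext000 e κ
  have hex : ∀ g : S.G000 e κ, ∃ a, R g a := by
    rintro ⟨g, hg⟩
    obtain ⟨⟨a, _⟩, hp, rfl⟩ := G000_le_map_proj hN hg
    obtain ⟨b, hb, c, hc, h⟩ := AddSubgroup.mem_sup.1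
      (show a ∈ S.A₀ e ⊔ A₁.carrier from Ext000_le_extSum A₁ hp)
    obtain rfl := h
    exact ⟨⟨b, hb⟩, c, hc, hp⟩
  have huniq : ∀ {g a a'}, R g a → R g a' →
      (QuotientAddGroup.mk (-a) : S.Quot₀ A₁) = QuotientAddGroup.mk (-a') := by
    rintro g a a' ⟨b, hb, h⟩ ⟨b', hb', h'⟩
    rw [mk_eq_mk_iff]
    have h1 : (⟨(a + b) - (a' + b'), 1⟩ : S.ExtStar e) = ⟨a + b, g⟩ * ⟨a' + b', g⟩⁻¹ := by
      rw [eq_mul_inv_iff_mul_eq, Ext.mul_def]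
      simp [(S.hStar e).map_one_left]
    have h2 : (⟨(a + b) - (a' + b'), 1⟩ : S.ExtStar e) ∈ S.Ext000 e κ :=
      h1 ▸ mul_mem h (inv_mem h')
    have h3 : ((a : S.AStar e) + b) - (a' + b') ∈ A₁.carrier := hA h2
    convert add_mem (sub_mem h3 hb) hb' using 1
    push_cast
    abel
  choose s hs using hex
  -- The sign is forced: multiplying in `Ext000` gives `s (x * y) ≡ s x + x • s y + h* (x, y)`
  -- modulo `A*₁`.
  let f : S.G000 e κ → S.Quot₀ A₁ := fun g => QuotientAddGroup.mk (-(s g))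
  have hf : ∀ {g : S.G000 e κ} {a}, R g a → f g = QuotientAddGroup.mk (-a) :=
    fun h => huniq (hs _) h
  refine ⟨f, fun σ hσ x y a b hxy hab hx => ?_, fun x y => ?_, ?_⟩
  · have hab' : b = a := Subtype.ext (by
      rw [← autA_of_mem_A₀ hσ a.2]
      exact cA_injective hab)
    rw [hab', ← hx]
    refine hf ?_
    obtain ⟨c, hc, h⟩ := hs x
    refine ⟨S.autA σ c, A₁.typeDefinable.isInvariant cA_injective σ hσ _ _ (S.cA_autA σ c) hc,
      isInvariant_comp000 _ _ _ σ hσ _ _ ?_ h⟩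
    rw [← cExt_autExt hσ]
    congr 1
    refine Ext.ext ?_ (cG_injective hxy)
    change (s x : S.AStar e) + S.autA σ c = S.autA σ ((s x : S.AStar e) + c)
    rw [map_add, autA_of_mem_A₀ hσ (s x).2]
  · obtain ⟨b, hb, h⟩ := hs x
    obtain ⟨c, hc, h'⟩ := hs y
    have h1 : R ((x * y : S.G000 e κ) : S.GStar e) (s x + S.actA₀ e x (s y)
        + ⟨(S.hStar e).toFun x y, S.hStar_mem e x y⟩) := by
      refine ⟨b + (x : S.GStar e) • c, add_mem hb (A₁.smul_mem _ _ hc), ?_⟩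
      convert mul_mem h h' using 1
      refine Ext.ext ?_ rfl
      change (s x : S.AStar e) + (x : S.GStar e) • (s y : S.AStar e) + (S.hStar e).toFun x y
        + (b + (x : S.GStar e) • c) = s x + b + (x : S.GStar e) • (s y + c) + (S.hStar e).toFun x y
      rw [smul_add]
      abel
    rw [hf h1]
    change S.hBar A₁ x y = QuotientAddGroup.mk (-s x) + QuotientAddGroup.mk (S.actA₀ e x (-s y))
      - QuotientAddGroup.mk _
    rw [← QuotientAddGroup.mk_add, ← QuotientAddGroup.mk_sub, map_neg]
    change QuotientAddGroup.mk _ = _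
    congr 1
    abel
  · have h1 : R ((1 : S.G000 e κ) : S.GStar e) 0 := ⟨0, zero_mem _, by
      convert one_mem (S.Ext000 e κ) using 1
      exact Ext.ext (add_zero _) rfl⟩
    rw [hf h1, neg_zero]
    rfl

/-- If the induced cocycle splits on `G000` via an invariant function, then
`Ext000 ∩ A* ⊆ A*₁`. -/
theorem interA_subset_of_splitting (hN : IsMonster L N κ) {f : S.G000 e κ → S.Quot₀ A₁}
    (hinv : S.IsInvariantFun A₁ _ f) (hf : S.SplitVia A₁ _ f) :
    Ext.interA (S.Ext000 e κ) ⊆ (A₁.carrier : Set (S.AStar e)) := by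
  obtain ⟨hf, hf1⟩ := hf
  choose s hs using fun g => QuotientAddGroup.mk_surjective (f g)
  -- With `φ p = p.fst + s p.snd`, the splitting identity reads `φ (p * r) ≡ φ p + p.snd • φ r`
  -- modulo `A*₁`, and `A*₁` is stable under the action and its inverse.
  have key : ∀ (p r : S.ExtStar e) (hp : p.snd ∈ S.G000 e κ) (hr : r.snd ∈ S.G000 e κ)
      (hq : (p * r).snd ∈ S.G000 e κ),
      ((p * r).fst + s ⟨_, hq⟩) - (p.fst + s ⟨_, hp⟩) ∈ A₁.carrier ↔
        r.fst + s ⟨_, hr⟩ ∈ A₁.carrier := by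
    intro p r hp hr hq
    have h1 := hf ⟨p.snd, hp⟩ ⟨r.snd, hr⟩
    rw [← hs, ← hs] at h1
    have h2 : f (⟨p.snd, hp⟩ * ⟨r.snd, hr⟩) = QuotientAddGroup.mk (s ⟨_, hq⟩) := (hs _).symm
    rw [h2] at h1
    change (QuotientAddGroup.mk _ : S.Quot₀ A₁) = QuotientAddGroup.mk _
      + QuotientAddGroup.mk (S.actA₀ e p.snd (s ⟨_, hr⟩)) - QuotientAddGroup.mk _ at h1
    rw [← QuotientAddGroup.mk_add, ← QuotientAddGroup.mk_sub, mk_eq_mk_iff] at h1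
    change (s ⟨p.snd, hp⟩ : S.AStar e) + p.snd • (s ⟨r.snd, hr⟩ : S.AStar e)
      - s ⟨_, hq⟩ - (S.hStar e).toFun p.snd r.snd ∈ A₁.carrier at h1
    change (p.fst + p.snd • r.fst + (S.hStar e).toFun p.snd r.snd + s ⟨_, hq⟩)
      - (p.fst + s ⟨_, hp⟩) ∈ A₁.carrier ↔ _
    rw [← A₁.carrier.add_mem_cancel_right h1]
    have h3 : p.fst + p.snd • r.fst + (S.hStar e).toFun p.snd r.snd + s ⟨_, hq⟩
        - (p.fst + s ⟨_, hp⟩) + ((s ⟨p.snd, hp⟩ : S.AStar e) + p.snd • (s ⟨r.snd, hr⟩ : S.AStar e)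
        - s ⟨_, hq⟩ - (S.hStar e).toFun p.snd r.snd) = p.snd • (r.fst + s ⟨_, hr⟩) := by
      rw [smul_add]
      abel
    rw [h3]
    exact ⟨fun h => by simpa using A₁.smul_mem p.snd⁻¹ _ h, A₁.smul_mem _ _⟩
  have hs1 : (s 1 : S.AStar e) ∈ A₁.carrier := by
    have := hs 1
    rw [hf1] at this
    exact (QuotientAddGroup.eq_zero_iff (s 1)).1 this
  -- The kernel of `φ` modulo `A*₁`, over `G000`.
  let K : Subgroup (S.ExtStar e) :=
    { carrier := {p | ∃ h : p.snd ∈ S.G000 e κ, p.fst + s ⟨_, h⟩ ∈ A₁.carrier}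
      one_mem' := ⟨one_mem (S.G000 e κ), add_mem (zero_mem A₁.carrier) hs1⟩
      mul_mem' := by
        rintro p r ⟨hp, h⟩ ⟨hr, h'⟩
        refine ⟨mul_mem hp hr, ?_⟩
        simpa using add_mem ((key p r hp hr (mul_mem hp hr)).2 h') h
      inv_mem' := by
        rintro p ⟨hp, h⟩
        refine ⟨inv_mem hp, (key p p⁻¹ hp (inv_mem hp) (mul_mem hp (inv_mem hp))).1 (sub_mem ?_ h)⟩
        have : ∀ (q : S.ExtStar e) (hq : q.snd ∈ S.G000 e κ), q = 1 →
            q.fst + s ⟨_, hq⟩ ∈ A₁.carrier := by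
          rintro _ hq rfl
          exact add_mem (zero_mem A₁.carrier) hs1
        exact this _ _ (mul_inv_cancel p) }
  have hK : S.Ext000 e κ ≤ K := by
    refine sInf_le ⟨?_, ?_⟩
    · rintro σ hσ p q hpq ⟨hp, h⟩
      obtain rfl : q = autExt hσ p := cExt_injective S (hpq.trans (cExt_autExt hσ p).symm)
      have hq : S.autG σ p.snd ∈ S.G000 e κ :=
        isInvariant_comp000 _ _ _ σ hσ _ _ (S.cG_autG σ p.snd) hp
      refine ⟨hq, ?_⟩
      have h1 := hinv σ hσ ⟨p.snd, hp⟩ ⟨_, hq⟩ (s ⟨_, hp⟩) (s ⟨_, hp⟩) (S.cG_autG σ p.snd)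
        (by rw [← S.cA_autA, autA_of_mem_A₀ hσ (s _).2]) (hs _).symm
      rw [← hs, mk_eq_mk_iff] at h1
      have h2 := A₁.typeDefinable.isInvariant cA_injective σ hσ _ _ (S.cA_autA σ _) h
      rw [SetLike.mem_coe, map_add, autA_of_mem_A₀ hσ (s _).2] at h2
      convert sub_mem h2 h1 using 1
      change S.autA σ p.fst + _ = _
      abel
    -- As `φ` is defined only over `G000`, first translate `p` by a representative of the coset of
    -- `p.snd`. That coset and the class of `φ` at the translate determine the coset of `p` modulo
    -- `K`.
    · have hrep : ∀ p : S.ExtStar e,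
          ((⟨0, (QuotientGroup.mk p.snd : S.GStar e ⧸ S.G000 e κ).out⟩ : S.ExtStar e)⁻¹ * p).snd
            ∈ S.G000 e κ := fun p => QuotientGroup.eq.1 (QuotientGroup.out_eq' _)
      refine (mk_quotient_le (Y := (S.GStar e ⧸ S.G000 e κ) × (S.AStar e ⧸ A₁.carrier))
        (fun p => (QuotientGroup.mk p.snd, QuotientAddGroup.mk (((⟨0, (QuotientGroup.mk p.snd :
          S.GStar e ⧸ S.G000 e κ).out⟩ : S.ExtStar e)⁻¹ * p).fst + s ⟨_, hrep p⟩)))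
        fun p q hpq => ?_).trans_lt ?_
      · obtain ⟨h1, h2⟩ := Prod.mk.inj hpq
        rw [QuotientAddGroup.eq] at h2
        -- The representatives are generalised to variables because the membership proofs fed to `s`
        -- depend on them.
        have h3 : ∀ t t' : S.ExtStar e, t = t' → ∀ (hp : (t⁻¹ * p).snd ∈ S.G000 e κ)
            (hq : (t'⁻¹ * q).snd ∈ S.G000 e κ), -((t⁻¹ * p).fst + (s ⟨_, hp⟩ : S.AStar e))
              + ((t'⁻¹ * q).fst + s ⟨_, hq⟩) ∈ A₁.carrier → p⁻¹ * q ∈ K := by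
          rintro t _ rfl hp hq h
          have h4 : t⁻¹ * q = t⁻¹ * p * (p⁻¹ * q) := by group
          have hr : (p⁻¹ * q).snd ∈ S.G000 e κ := by
            have h5 := mul_mem (inv_mem hp) hq
            convert h5 using 1
            change (proj (p⁻¹ * q) : S.GStar e) = (proj (t⁻¹ * p))⁻¹ * proj (t⁻¹ * q)
            rw [← map_inv, ← map_mul]
            congr 1
            group
          rw [neg_add_eq_sub] at h
          have h6 : ∀ (x : S.ExtStar e) (hx : x.snd ∈ S.G000 e κ), x = t⁻¹ * q →
              (x.fst + s ⟨_, hx⟩) - ((t⁻¹ * p).fst + (s ⟨_, hp⟩ : S.AStar e)) ∈ A₁.carrier := by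
            rintro _ _ rfl
            exact h
          exact ⟨hr, (key _ _ hp hr (mul_mem hp hr)).1 (h6 _ _ h4.symm)⟩
        exact h3 _ _ (by rw [h1]) (hrep p) (hrep q) h2
      · rw [mk_prod, Cardinal.lift_id, Cardinal.lift_id]
        exact mul_lt_of_lt hN.uncountable.le (mk_quotient_G000_lt hN) A₁.bounded
  intro a ha
  obtain ⟨h1, h2⟩ := hK ha
  have h3 : a + (s 1 : S.AStar e) ∈ A₁.carrier := h2
  simpa using sub_mem h3 hs1

end Splitting

end Situation

end ConnComp

/-! ### A counting lemma on sets with gaps -/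

namespace ConnComp

universe u v w w'

/-- Countably many sets of natural numbers, the `n`-th of which has gaps larger than `2 ^ (n + 2)`,
are such that no finitely many of them cover the natural numbers. -/
theorem exists_not_of_gaps {P : ℕ → ℕ → Prop}
    (h : ∀ n k k', k < k' → P n k → P n k' → 2 ^ (n + 2) < k' - k) (R : ℕ) :
    ∃ k, ∀ n < R, ¬ P n k := by
  classical
  by_contra! hcov
  let T := 2 ^ (R + 2)
  have h1 : Finset.range T ⊆ (Finset.range R).biUnion fun n => (Finset.range T).filter (P n) := by
    intro k hk
    obtain ⟨n, hn, hP⟩ := hcov k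
    exact Finset.mem_biUnion.2 ⟨n, Finset.mem_range.2 hn, Finset.mem_filter.2 ⟨hk, hP⟩⟩
  -- Cut `[0, 2 ^ (R + 2))` into `2 ^ (R - n)` blocks of length `2 ^ (n + 2)`; each contains at most
  -- one point of `P n`. The sum over `n < R` is `2 ^ (R + 1) - 2`, too few to cover.
  have h2 : ∀ n < R, ((Finset.range T).filter (P n)).card ≤ 2 ^ (R - n) := by
    intro n hn
    rw [← Finset.card_range (2 ^ (R - n))]
    have hT : T = 2 ^ (n + 2) * 2 ^ (R - n) := by
      rw [← pow_add, show n + 2 + (R - n) = R + 2 by omega]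
    refine Finset.card_le_card_of_injOn (fun k => k / 2 ^ (n + 2)) (fun k hk => ?_)
      fun k hk k' hk' hkk' => ?_
    · have := Finset.mem_range.1 (Finset.mem_filter.1 hk).1
      exact Finset.mem_coe.2 (Finset.mem_range.2 (Nat.div_lt_of_lt_mul (hT ▸ this)))
    · have key : ∀ {k k'}, P n k → P n k' → k / 2 ^ (n + 2) = k' / 2 ^ (n + 2) → ¬ k < k' := by
        intro k k' hk hk' hkk' hlt
        have h3 := h n k k' hlt hk hk'
        have h4 := Nat.lt_div_mul_add (a := k') (b := 2 ^ (n + 2)) (by positivity)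
        have h5 := Nat.div_mul_le_self k (2 ^ (n + 2))
        rw [hkk'] at h5
        omega
      have hk := (Finset.mem_filter.1 hk).2
      have hk' := (Finset.mem_filter.1 hk').2
      exact le_antisymm (not_lt.1 (key hk' hk hkk'.symm)) (not_lt.1 (key hk hk' hkk'))
  have h3 : ∀ R : ℕ, ∑ n ∈ Finset.range R, 2 ^ (R - n) + 2 = 2 ^ (R + 1) := by
    intro R
    induction R with
    | zero => simp
    | succ R ih =>
      rw [Finset.sum_range_succ']
      simp only [Nat.add_sub_add_right, Nat.sub_zero]
      rw [add_right_comm, ih]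
      ring
  have h4 := (Finset.card_le_card h1).trans (Finset.card_biUnion_le.trans
    (Finset.sum_le_sum fun n hn => h2 n (Finset.mem_range.1 hn)))
  rw [Finset.card_range] at h4
  have h5 := h3 R
  have h6 : T = 2 * 2 ^ (R + 1) := by ring
  omega

/-! ### Type-definable subgroups in the torsion free case -/

namespace Situation

variable {L : FirstOrder.Language.{u, v}} {M : Type w} {N : Type w'} [L.Structure M]
  [L.Structure N] {G A : Type*} [Group G] [AddCommGroup A] [DistribMulAction G A]
  {S : Situation L M G A} {e : M ↪ₑ[L] N} {κ : Cardinal.{w'}} (A₁ : S.BoundedSubgroup e κ)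

variable (S e) in
-- A finitely generated abelian group is countable. This makes `A₀` usable as a small parameter set
-- and lets its elements be enumerated.
theorem countable_A₀ : Countable (S.A₀ e) := by
  have h1 : (Set.range fun p : G × G => S.embA e (S.h.toFun p.1 p.2)).Finite := by
    have := S.finite_im.image (S.embA e)
    rwa [← Set.range_comp] at this
  have := h1.to_subtype
  let φ : ((Set.range fun p : G × G => S.embA e (S.h.toFun p.1 p.2)) →₀ ℤ) → S.AStar e :=
    Finsupp.linearCombination ℤ Subtype.val
  refine (Set.countable_coe_iff.2 ((Set.countable_range φ).mono fun a ha => ?_) :)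
  rw [SetLike.mem_coe, A₀, ← Submodule.span_int_eq_addSubgroupClosure,
    Submodule.mem_toAddSubgroup, Finsupp.mem_span_iff_linearCombination] at ha
  exact ha

/-- The graph of the translation by a parameter is definable. -/
theorem exists_definable_graph_add {C : Set N} {d : S.AStar e} (hd : ∀ i, S.cA d i ∈ C) :
    ∃ E : Set (Fin S.m ⊕ Fin S.m → N), C.Definable L E ∧
      ∀ y z : S.AStar e, Sum.elim (S.cA y) (S.cA z) ∈ E ↔ d + y = z :=
  ⟨_, definable_subst ((definable_interp e S.definable_add).mono (by simp)) hd,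
    fun _ _ => S.addStar_iff.symm⟩

/-- The tuples of elements of `A*` whose translate by `-a` lies in a definable set are definable. -/
theorem exists_definable_translate {C : Set N} {V : Set (Fin S.m → N)} (hBC : S.BStar e ⊆ C)
    (hV : C.Definable L V) {a : S.AStar e} (ha : ∀ i, S.cA a i ∈ C) :
    ∃ D : Set (Fin S.m → N), C.Definable L D ∧ ∀ x : S.AStar e, S.cA x ∈ D ↔ S.cA (x - a) ∈ V := by
  obtain ⟨E, hE, hE'⟩ := exists_definable_graph_add ha
  refine ⟨_, (((hV.inter (S.definable_range_cA.mono hBC)).preimage_comp Sum.inr).inter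
    (hE.preimage_comp Sum.swap)).exists_of_finite, fun x => ?_⟩
  have hswap : ∀ y : S.AStar e, Sum.elim (S.cA x) (S.cA y) ∘ Sum.swap
      = Sum.elim (S.cA y) (S.cA x) := fun y => by
    funext i
    rcases i with i | i <;> rfl
  constructor
  · rintro ⟨t, ⟨hy, ⟨y, hyt : _ = t⟩⟩, h⟩
    subst hyt
    have h3 : a + y = x := (hE' y x).1 (hswap y ▸ h)
    rw [← h3, add_sub_cancel_left]
    exact hy
  · intro h
    refine ⟨S.cA (x - a), ⟨h, ⟨_, rfl⟩⟩, ?_⟩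
    rw [Set.mem_preimage, hswap, hE']
    exact add_sub_cancel a x

/-- If `d ∉ A*₁`, then `A*₁` is contained in a definable set no two of whose elements differ
by `d`. -/
theorem exists_definable_sub_ne (hN : IsMonster L N κ) {C : Set N} (hC : #C < κ)
    (hBC : S.BStar e ⊆ C) {d : S.AStar e} (hd : ∀ i, S.cA d i ∈ C) (hdA : d ∉ A₁.carrier) :
    ∃ V : Set (Fin S.m → N), C.Definable L V ∧ (∀ a ∈ A₁.carrier, S.cA a ∈ V) ∧
      ∀ u v : S.AStar e, S.cA u ∈ V → S.cA v ∈ V → u - v ≠ d := by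
  obtain ⟨F, hF, hFA⟩ := A₁.typeDefinable
  by_contra! hcon
  obtain ⟨E, hE, hE'⟩ := exists_definable_graph_add hd
  -- The extra member keeps the family nonempty, so that a realisation lies in the graph `E` even if
  -- `F` is empty.
  let F' : Set (Set (Fin S.m → N)) := insert (Set.range (S.cA (e := e))) F
  have hF' : ∀ D ∈ F', C.Definable L D := by
    rintro _ (rfl | hD)
    · exact S.definable_range_cA.mono hBC
    · exact (hF _ hD).mono hBC
  -- If every definable set around `A*₁` had two elements differing by `d`, compactness would give
  -- two such elements in `A*₁` itself.
  obtain ⟨w, hw⟩ := hN.saturated.compactness hC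
    ((fun D => {w : Fin S.m ⊕ Fin S.m → N | (w ∘ Sum.inl ∈ D ∧ w ∘ Sum.inr ∈ D) ∧ w ∈ E}) '' F')
    (by
      rintro _ ⟨D, hD, rfl⟩
      exact (((hF' D hD).preimage_comp Sum.inl).inter ((hF' D hD).preimage_comp Sum.inr)).inter hE)
    (by
      intro T hT hfin
      classical
      obtain ⟨T, hT', hTT⟩ := Finset.subset_set_image_iff.1 ((hfin.coe_toFinset).symm ▸ hT)
      obtain ⟨u, v, hu, hv, huv⟩ := hcon (⋂ D ∈ T.subtype fun D => D ∈ F', D)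
        (Set.definable_biInter_finset (f := fun D : {D // D ∈ F'} =>
          (D : Set (Fin S.m → N))) (fun D => hF' D D.2) _)
        (fun a ha => Set.mem_iInter₂.2 fun D hD => by
          obtain ⟨D, rfl | hD'⟩ := D
          · exact ⟨a, rfl⟩
          · exact (hFA.le ⟨a, ha, rfl⟩ : S.cA a ∈ ⋂₀ F) D hD')
      refine ⟨Sum.elim (S.cA v) (S.cA u), fun D hD => ?_⟩
      rw [← hfin.mem_toFinset, ← hTT] at hD
      obtain ⟨D, hDT, rfl⟩ := Finset.mem_image.1 hD
      have h3 : D ∈ F' := hT' hDT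
      refine ⟨⟨Set.mem_iInter₂.1 hv ⟨D, h3⟩ (Finset.mem_subtype.2 hDT),
        Set.mem_iInter₂.1 hu ⟨D, h3⟩ (Finset.mem_subtype.2 hDT)⟩, (hE' _ _).2 ?_⟩
      exact (eq_add_of_sub_eq huv).symm)
  have h3 : ∀ D ∈ F', (w ∘ Sum.inl ∈ D ∧ w ∘ Sum.inr ∈ D) ∧ w ∈ E := fun D hD => hw _ ⟨D, hD, rfl⟩
  obtain ⟨v, hv, hvw⟩ := hFA.ge (fun D hD => (h3 D (Or.inr hD)).1.1 : w ∘ Sum.inl ∈ ⋂₀ F)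
  obtain ⟨u, hu, huw⟩ := hFA.ge (fun D hD => (h3 D (Or.inr hD)).1.2 : w ∘ Sum.inr ∈ ⋂₀ F)
  have h4 : d + v = u := by
    rw [← hE', hvw, huw, Sum.elim_comp_inl_inr]
    exact (h3 _ (Or.inl rfl)).2
  exact hdA (eq_sub_of_add_eq h4 ▸ sub_mem hu hv)

/-- A type-definable subgroup of `(A₀ + A*₁) × G*` which contains `A*₁` meets `A*` in `A*₁`, if
`A₀ / (A*₁ ∩ A₀)` is torsion free. -/
theorem interA_subset_of_isTypeDefinable (hN : IsMonster L N κ) [IsAddTorsionFree (S.Quot₀ A₁)]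
    {K : Subgroup (S.ExtStar e)} (hK : IsTypeDefinable L (S.cExt e) (S.BStar e) (K : Set _))
    (hKA : K ≤ extSum A₁) (hA : (A₁.carrier : Set (S.AStar e)) ⊆ Ext.interA K) :
    Ext.interA K ⊆ (A₁.carrier : Set (S.AStar e)) := by
  let KA : AddSubgroup (S.AStar e) :=
    { carrier := Ext.interA K
      zero_mem' := one_mem K
      add_mem' := by
        intro a b ha hb
        change (⟨a + b, 1⟩ : S.ExtStar e) ∈ K
        have := mul_mem (S := Subgroup (S.ExtStar e)) ha hb
        simpa [Ext.mul_def, (S.hStar e).map_one_left] using this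
      neg_mem' := by
        intro a ha
        change (⟨-a, 1⟩ : S.ExtStar e) ∈ K
        have := inv_mem (S := Subgroup (S.ExtStar e)) ha
        simpa [Ext.inv_def, (S.hStar e).map_one_left] using this }
  have := S.countable_A₀ e
  let C : Set N := S.BStar e ∪ (Set.range (S.cG (1 : S.GStar e)) ∪
    ⋃ a : S.A₀ e, Set.range (S.cA (a : S.AStar e)))
  have hBC : S.BStar e ⊆ C := Set.subset_union_left
  have hGC : ∀ i, S.cG (1 : S.GStar e) i ∈ C := fun i => Or.inr (Or.inl ⟨i, rfl⟩)
  have hAC : ∀ a ∈ S.A₀ e, ∀ i, S.cA a i ∈ C := fun a ha i =>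
    Or.inr (Or.inr (Set.mem_iUnion.2 ⟨⟨a, ha⟩, i, rfl⟩))
  have hC : #C < κ := by
    refine lt_of_le_of_lt (Cardinal.mk_le_aleph0_iff.2 ?_) hN.uncountable
    exact ((S.finite_BStar.countable.union ((Set.countable_range (S.cG (1 : S.GStar e))).union
      (Set.countable_iUnion fun a : S.A₀ e => Set.countable_range (S.cA (a : S.AStar e))))) :)
  by_contra hcon
  obtain ⟨a, haK, haA⟩ := Set.not_subset.1 hcon
  -- Discarding the `A*₁`-part replaces `a` by an element `c` of `A₀`; torsion freeness then keeps
  -- all its nonzero multiples out of `A*₁`.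
  obtain ⟨c, hc, b, hb, rfl⟩ := AddSubgroup.mem_sup.1
    (show a ∈ S.A₀ e ⊔ A₁.carrier from hKA haK)
  have hcK : c ∈ KA := (KA.add_mem_cancel_right (hA hb)).1 haK
  have hcA : ∀ i : ℕ, i ≠ 0 → i • c ∉ A₁.carrier := by
    intro i hi h
    have h1 : i • (QuotientAddGroup.mk ⟨c, hc⟩ : S.Quot₀ A₁) = 0 := by
      rw [← QuotientAddGroup.mk_nsmul]
      exact (QuotientAddGroup.eq_zero_iff (i • (⟨c, hc⟩ : S.A₀ e))).2 h
    rw [nsmul_eq_zero_iff_right hi] at h1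
    exact haA (add_mem ((QuotientAddGroup.eq_zero_iff (⟨c, hc⟩ : S.A₀ e)).1 h1) hb)
  have hV : ∀ i : ℕ, ∃ V : Set (Fin S.m → N), C.Definable L V ∧
      (∀ a ∈ A₁.carrier, S.cA a ∈ V) ∧
      ∀ u v : S.AStar e, S.cA u ∈ V → S.cA v ∈ V → u - v ≠ (i + 1) • c := fun i =>
    exists_definable_sub_ne A₁ hN hC hBC (hAC _ (nsmul_mem hc _)) (hcA _ i.succ_ne_zero)
  choose V hVd hVA hVc using hV
  obtain ⟨s, hs⟩ := exists_surjective_nat (S.A₀ e)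
  -- `D n` contains the coset `s n + A*₁`, and two multiples of `c` in it are more than `2 ^ (n +
  -- 2)` steps apart. By the counting lemma no finitely many `D n` contain all multiples of `c`.
  choose D hDd hD using fun n => exists_definable_translate (V := ⋂ i ∈ Finset.range (2 ^ (n + 2)), V i)
    hBC (Set.definable_biInter_finset hVd _) (hAC _ (s n).2)
  obtain ⟨F, hF, hFK⟩ := hK
  -- The goal is a point of `K ∩ A*` outside every `D n`; multiples of `c` satisfy each finite part
  -- of these conditions.
  obtain ⟨w, hw⟩ := hN.saturated.compactness hC
    ((fun E => {v | Sum.elim v (S.cG (1 : S.GStar e)) ∈ E}) '' F ∪ Set.range fun n => (D n)ᶜ)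
    (by
      rintro _ (⟨E, hE, rfl⟩ | ⟨n, rfl⟩)
      · exact definable_subst_right ((hF E hE).mono hBC) hGC
      · exact (hDd n).compl)
    (by
      intro T hT hfin
      obtain ⟨R, hR⟩ : ∃ R, ∀ E ∈ T, E ∈ Set.range (fun n => (D n)ᶜ) → ∃ n < R, E = (D n)ᶜ := by
        choose! ν hν using fun (E : Set (Fin S.m → N)) (hE : E ∈ Set.range fun n => (D n)ᶜ) => hE
        obtain ⟨R, hR⟩ := (hfin.image ν).bddAbove
        exact ⟨R + 1, fun E hE hE' => ⟨ν E, Nat.lt_succ_of_le (hR ⟨E, hE, rfl⟩), (hν E hE').symm⟩⟩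
      obtain ⟨k, hk⟩ := exists_not_of_gaps (P := fun n k => S.cA (k • c) ∈ D n) (by
        intro n k k' hkk' h h'
        rw [hD] at h h'
        by_contra! hle
        obtain ⟨i, rfl⟩ := Nat.exists_eq_add_of_lt hkk'
        have hi : i ∈ Finset.range (2 ^ (n + 2)) := Finset.mem_range.2 (by omega)
        refine hVc i _ _ (Set.mem_iInter₂.1 h' i hi) (Set.mem_iInter₂.1 h i hi) ?_
        rw [sub_sub_sub_cancel_right, add_assoc, add_nsmul, add_sub_cancel_left]) R
      refine ⟨S.cA (k • c), fun E hE => ?_⟩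
      rcases hT hE with ⟨E, hEF, rfl⟩ | hE'
      · exact (hFK.le ⟨⟨k • c, 1⟩, nsmul_mem hcK k, rfl⟩ :
          S.cExt e ⟨k • c, 1⟩ ∈ ⋂₀ F) E hEF
      · obtain ⟨n, hn, rfl⟩ := hR E hE hE'
        exact hk n hn)
  obtain ⟨⟨x, g⟩, hx, hxw⟩ := hFK.ge (fun E hE => hw _ (Or.inl ⟨E, hE, rfl⟩) :
    Sum.elim w (S.cG (1 : S.GStar e)) ∈ ⋂₀ F)
  obtain rfl : S.cA x = w := funext fun i => congrFun hxw (Sum.inl i)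
  -- But `K` lies over `A₀ + A*₁`, so `x` is in `s n + A*₁ ⊆ D n` for some `n`.
  obtain ⟨a', ha', b', hb', hab⟩ := AddSubgroup.mem_sup.1
    (show x ∈ S.A₀ e ⊔ A₁.carrier from hKA hx)
  obtain ⟨n, hn⟩ := hs ⟨a', ha'⟩
  refine hw _ (Or.inr ⟨n, rfl⟩) ((hD n x).2 (Set.mem_iInter₂.2 fun i _ => hVA i _ ?_))
  rw [hn, ← hab, add_sub_cancel_left]
  exact hb'

end Situation

end ConnComp

/-! ### The theorem -/

theorem mainTheorem4
    {L : FirstOrder.Language} {M N : Type*} [L.Structure M] [L.Structure N]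
    {G A : Type*} [Group G] [AddCommGroup A] [DistribMulAction G A]
    (S : ConnComp.Situation L M G A) (e : M ↪ₑ[L] N)
    (κ : Cardinal) (hN : ConnComp.IsMonster L N κ) (A₁ : S.BoundedSubgroup e κ) :
    (S.G000 e κ = S.G00 e κ →
      (A₁.carrier : Set (S.AStar e)) ⊆ ConnComp.Ext.interA (S.Ext000 e κ) →
        (S.Ext000 e κ ≠ S.Ext00 e κ →
          ¬ ConnComp.Ext.interA (S.Ext00 e κ) ⊆ (A₁.carrier : Set (S.AStar e))) ∧
        (IsAddTorsionFree (S.Quot₀ A₁) →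
          ¬ ConnComp.Ext.interA (S.Ext00 e κ) ⊆ (A₁.carrier : Set (S.AStar e)) →
            S.Ext000 e κ ≠ S.Ext00 e κ)) ∧
    (S.NonSplitInvariant A₁ (S.G000 e κ) ↔
      ¬ ConnComp.Ext.interA (S.Ext000 e κ) ⊆ (A₁.carrier : Set (S.AStar e))) := by
  open ConnComp Situation in
  refine ⟨fun hG hA => ⟨fun hne h => hne (Ext000_eq_Ext00 hN hG (h.trans hA)),
    fun htf h heq => h ?_⟩, not_congr ⟨?_, exists_splitting A₁ hN⟩⟩
  -- Equality of the components gives one group with both features: type-definable as `Ext00`, and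
  -- contained in `extSum A₁` as `Ext000`.
  · exact interA_subset_of_isTypeDefinable A₁ hN
      (isTypeDefinable_comp00 S.cExt_injective S.definable_range_cExt κ)
      (heq ▸ Ext000_le_extSum A₁) (heq ▸ hA)
  · rintro ⟨f, hinv, hf⟩
    exact interA_subset_of_splitting A₁ hN hinv hf
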